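/- Let $L$ be a multi-sorted signature with base types, uninterpreted predicate symbols $p$ (each with a list of argument types), and function symbols $f$ and relation symbols $R$ with a fixed interpretation. Constants are identified with the elements of the base types, and constants and predicate symbols are represented by pairwise distinct (within each type) binary strings. The formulae of $\mathrm{PTLTL}^{FO}$ over $L$ are $$\psi ::= p(t_1,\dots,t_m)\mid R(t_1,\dots,t_n)\mid \psi\wedge\psi\mid\neg\psi\mid \mathbf X^{-1}\psi\mid \psi\,\mathbf S\,\psi\mid \forall(x_1,\dots,x_n){:}p.\,\psi \quad (n\ge 1\text{ the arity of }p),$$ where the $t_i$ are well-typed terms built from variables, constants and function symbols, and $t{\downarrow}$ denotes the value of a closed term $t$. A policy is a closed formula. An event is $p(c_1,\dots,c_n)$ with constants $c_i$, a session is a finite set of events, and a history $h$ is a finite nonempty list of sessions $h_1,\dots,h_{|h|}$; its size is the number of symbols needed to write it out. For $1\le i\le |h|$ and closed $\psi$, the relation $(h,i)\models\psi$ is defined by: $(h,i)\models p(\vec t)$ iff $p(\vec t{\downarrow})\in h_i$; $(h,i)\models R(\vec t)$ iff $R(\vec t{\downarrow})$ is true; $\wedge$ and $\neg$ as usual; $(h,i)\models\mathbf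 X^{-1}\psi$ iff $i>1$ and $(h,i-1)\models\psi$; $(h,i)\models\psi_1\,\mathbf S\,\psi_2$ iff there is $1\le j\le i$ with $(h,j)\models\psi_2$ and $(h,k)\models\psi_1$ for all $j<k\le i$; $(h,i)\models\forall\vec x{:}p.\,\psi$ iff $(h,i)\models\psi[\vec x:=\vec c]$ for all $\vec c$ with $p(\vec c)\in h_i$. Write $h\models\varphi$ for $(h,|h|)\models\varphi$. Theorem. Fix a policy $\varphi$ such that the interpretations of all function and relation symbols that occur in $\varphi$ are computable in polynomial time. Then the problem of deciding, given a nonempty history $h$, whether $h\models\varphi$ is solvable by a Turing machine in time polynomial in the size of $h$. -/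

import Mathlib

namespace PTLTL

open Computability Turing

/-- An interpreted multi-sorted signature: base types with their elements, uninterpreted predicate
symbols, and function and relation symbols with a fixed interpretation. A constant is identified
with the element that it denotes. Elements and predicate names are written as binary strings. -/
structure Signature where
  /-- base types -/
  BaseType : Type
  /-- the elements (equivalently, the constants) of a base type -/
  Dom : BaseType → Type
  /-- the string that represents a constant -/
  code : {τ : BaseType} → Dom τ → List Bool
  code_injective : ∀ τ : BaseType, Function.Injective (code : Dom τ → List Bool)
  /-- uninterpreted predicate symbols -/
  Pred : Type
  /-- the string that represents a predicate symbol -/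
  predName : Pred → List Bool
  predName_injective : Function.Injective predName
  predArity : Pred → ℕ
  predType : (p : Pred) → Fin (predArity p) → BaseType
  /-- interpreted function symbols -/
  Fn : Type
  fnArity : Fn → ℕ
  fnDom : (f : Fn) → Fin (fnArity f) → BaseType
  fnCod : Fn → BaseType
  fnInterp : (f : Fn) → ((i : Fin (fnArity f)) → Dom (fnDom f i)) → Dom (fnCod f)
  /-- interpreted relation symbols -/
  Rel : Type
  relArity : Rel → ℕ
  relType : (R : Rel) → Fin (relArity R) → BaseType
  relInterp : (R : Rel) → ((i : Fin (relArity R)) → Dom (relType R i)) → Prop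

/-- Terms of each base type, over a type `V` of variables `x` of base type `Γ x`. -/
inductive Term (L : Signature) {V : Type} (Γ : V → L.BaseType) : L.BaseType → Type
  | var (x : V) : Term L Γ (Γ x)
  | const {τ : L.BaseType} (a : L.Dom τ) : Term L Γ τ
  | app (f : L.Fn) (t : (i : Fin (L.fnArity f)) → Term L Γ (L.fnDom f i)) :
      Term L Γ (L.fnCod f)

/-- Formulae whose free variables are among the typed variables `Γ` (up to renaming of bound
variables). The quantifier `∀ (x₁, …, xₙ) : p. ψ`, with `n ≥ 1` the arity of `p`, adds the
variables `x₁, …, xₙ` (the left summand), typed as the arguments of `p`, to the scope of `ψ`. -/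
inductive Formula (L : Signature) : {V : Type} → (V → L.BaseType) → Type 1
  | atom {V : Type} {Γ : V → L.BaseType} (p : L.Pred)
      (t : (i : Fin (L.predArity p)) → Term L Γ (L.predType p i)) : Formula L Γ
  | rel {V : Type} {Γ : V → L.BaseType} (R : L.Rel)
      (t : (i : Fin (L.relArity R)) → Term L Γ (L.relType R i)) : Formula L Γ
  | and {V : Type} {Γ : V → L.BaseType} (ψ₁ ψ₂ : Formula L Γ) : Formula L Γ
  | neg {V : Type} {Γ : V → L.BaseType} (ψ : Formula L Γ) : Formula L Γ
  | prev {V : Type} {Γ : V → L.BaseType} (ψ : Formula L Γ) : Formula L Γ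
  | since {V : Type} {Γ : V → L.BaseType} (ψ₁ ψ₂ : Formula L Γ) : Formula L Γ
  | all {V : Type} {Γ : V → L.BaseType} (p : L.Pred) (hp : 1 ≤ L.predArity p)
      (ψ : Formula L (V := Fin (L.predArity p) ⊕ V) (Sum.elim (L.predType p) Γ)) : Formula L Γ

/-- A policy is a closed formula. -/
abbrev Policy (L : Signature) : Type 1 := Formula L (V := Empty) (fun x => x.elim)

/-- An event `p(c₁, …, cₙ)`. -/
abbrev Event (L : Signature) : Type :=
  Σ p : L.Pred, (i : Fin (L.predArity p)) → L.Dom (L.predType p i)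

/-- A history is a finite list of sessions, and a session is a finite set of events. -/
abbrev History (L : Signature) : Type := List (Finset (Event L))

/-- The `i`-th session of a history, for `1 ≤ i ≤ |h|`. -/
def History.session {L : Signature} (h : History L) (i : ℕ) : Finset (Event L) :=
  h.getD (i - 1) ∅

/-- The value of a term under an assignment `ρ` of elements to its variables. -/
def Term.eval {L : Signature} {V : Type} {Γ : V → L.BaseType} (ρ : (x : V) → L.Dom (Γ x)) :
    {τ : L.BaseType} → Term L Γ τ → L.Dom τ
  | _, .var x => ρ x
  | _, .const a => a
  | _, .app f t => L.fnInterp f (fun i => (t i).eval ρ)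

/-- The assignment that gives the values `c` to the newly bound variables and agrees with `ρ` on
the others. -/
def extend {L : Signature} {n : ℕ} {V : Type} {Δ : Fin n → L.BaseType} {Γ : V → L.BaseType}
    (c : (i : Fin n) → L.Dom (Δ i)) (ρ : (x : V) → L.Dom (Γ x)) :
    (x : Fin n ⊕ V) → L.Dom (Sum.elim Δ Γ x)
  | .inl i => c i
  | .inr x => ρ x

/-- The forcing relation `(h, i) ⊨ ψ`, where `1 ≤ i ≤ |h|` and the free variables of `ψ` are
replaced according to the assignment `ρ`. -/
def Holds {L : Signature} (h : History L) :
    {V : Type} → {Γ : V → L.BaseType} → Formula L Γ → ((x : V) → L.Dom (Γ x)) → ℕ → Prop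
  | _, _, .atom p t, ρ, i => (⟨p, fun k => (t k).eval ρ⟩ : Event L) ∈ h.session i
  | _, _, .rel R t, ρ, _ => L.relInterp R (fun k => (t k).eval ρ)
  | _, _, .and ψ₁ ψ₂, ρ, i => Holds h ψ₁ ρ i ∧ Holds h ψ₂ ρ i
  | _, _, .neg ψ, ρ, i => ¬ Holds h ψ ρ i
  | _, _, .prev ψ, ρ, i => 1 < i ∧ Holds h ψ ρ (i - 1)
  | _, _, .since ψ₁ ψ₂, ρ, i =>
      ∃ j, 1 ≤ j ∧ j ≤ i ∧ Holds h ψ₂ ρ j ∧ ∀ k, j < k → k ≤ i → Holds h ψ₁ ρ k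
  | _, _, .all p _ ψ, ρ, i =>
      ∀ c : (k : Fin (L.predArity p)) → L.Dom (L.predType p k),
        (⟨p, c⟩ : Event L) ∈ h.session i → Holds h ψ (extend c ρ) i

/-- `h ⊨ φ`, that is `(h, |h|) ⊨ φ`, for a nonempty history `h` and a policy `φ`. -/
def Satisfies {L : Signature} (h : History L) (φ : Policy L) : Prop :=
  Holds h φ (fun x => x.elim) h.length

/-- The function symbol `f` occurs in a term. -/
def Term.HasFn {L : Signature} {V : Type} {Γ : V → L.BaseType} (f : L.Fn) :
    {τ : L.BaseType} → Term L Γ τ → Prop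
  | _, .var _ => False
  | _, .const _ => False
  | _, .app g t => g = f ∨ ∃ i, (t i).HasFn f

/-- The function symbol `f` occurs in a formula. -/
def Formula.HasFn {L : Signature} (f : L.Fn) :
    {V : Type} → {Γ : V → L.BaseType} → Formula L Γ → Prop
  | _, _, .atom _ t => ∃ i, (t i).HasFn f
  | _, _, .rel _ t => ∃ i, (t i).HasFn f
  | _, _, .and ψ₁ ψ₂ => ψ₁.HasFn f ∨ ψ₂.HasFn f
  | _, _, .neg ψ => ψ.HasFn f
  | _, _, .prev ψ => ψ.HasFn f
  | _, _, .since ψ₁ ψ₂ => ψ₁.HasFn f ∨ ψ₂.HasFn f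
  | _, _, .all _ _ ψ => ψ.HasFn f

/-- The interpreted relation symbol `R` occurs in a formula. -/
def Formula.HasRel {L : Signature} (R : L.Rel) :
    {V : Type} → {Γ : V → L.BaseType} → Formula L Γ → Prop
  | _, _, .atom _ _ => False
  | _, _, .rel R' _ => R' = R
  | _, _, .and ψ₁ ψ₂ => ψ₁.HasRel R ∨ ψ₂.HasRel R
  | _, _, .neg ψ => ψ.HasRel R
  | _, _, .prev ψ => ψ.HasRel R
  | _, _, .since ψ₁ ψ₂ => ψ₁.HasRel R ∨ ψ₂.HasRel R
  | _, _, .all _ _ ψ => ψ.HasRel R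

/-! ### Strings -/

/-- A tuple `c₁, …, cₙ` of constants, written as a string: each constant is followed by a comma. -/
def codeTuple {L : Signature} {n : ℕ} {Δ : Fin n → L.BaseType} (c : (i : Fin n) → L.Dom (Δ i)) :
    List Γ' :=
  (List.ofFn fun i => (L.code (c i)).map Γ'.bit ++ [Γ'.comma]).flatten

/-- An event written as a string: the name of the predicate and its arguments, in brackets. -/
def codeEvent {L : Signature} (e : Event L) : List Γ' :=
  Γ'.bra :: ((L.predName e.1).map Γ'.bit ++ Γ'.comma :: codeTuple e.2 ++ [Γ'.ket])

/-- A written-out nonempty history: a nonempty list of sessions, where the events of each session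
are listed in an arbitrary order. (Repetitions are allowed. The string of a listing without
repetitions has as many symbols for every order of the events.) -/
def Listing (L : Signature) : Type := {w : List (List (Event L)) // w ≠ []}

open Classical in
/-- The history that is written out by a listing. -/
noncomputable def Listing.toHistory {L : Signature} (w : Listing L) : History L :=
  w.1.map List.toFinset

/-- A listed history written as a string: each session is the sequence of its events, in
brackets. The number of symbols of a history is the length of this string, for a listing without
repetitions. -/
def Listing.code {L : Signature} (w : Listing L) : List Γ' :=
  (w.1.map fun s => Γ'.bra :: (s.map codeEvent).flatten ++ [Γ'.ket]).flatten

/-! ### Polynomial time -/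

/-- The interpretation of the function symbol `f` is computable by a (multi-stack) Turing machine
in time polynomial in the number of symbols of the arguments. -/
def Signature.PolyTimeFn (L : Signature) (f : L.Fn) : Prop :=
  Nonempty (TM2ComputableInPolyTime codeTuple L.code (L.fnInterp f))

open Classical in
/-- The interpretation of the relation symbol `R` is decidable by a (multi-stack) Turing machine
in time polynomial in the number of symbols of the arguments. -/
def Signature.PolyTimeRel (L : Signature) (R : L.Rel) : Prop :=
  Nonempty (TM2ComputableInPolyTime codeTuple encodeBool (fun c => decide (L.relInterp R c)))

open Classical in
/-- The decision problem "`h ⊨ φ`?" for the fixed policy `φ`, whose instances are the (written-out)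
nonempty histories `h`, is solvable by a (multi-stack) Turing machine in time polynomial in the
size of `h`. -/
def Policy.DecidableInPolyTime {L : Signature} (φ : Policy L) : Prop :=
  Nonempty (TM2ComputableInPolyTime Listing.code encodeBool
    (fun w : Listing L => decide (Satisfies w.toHistory φ)))

end PTLTL

namespace PTLTL

open Computability Turing

/-! ### Runs of stack machines -/

section Machine

variable {K : Type} [DecidableEq K] {Γ : K → Type} {Λ Λ' σ : Type}

/-! The logic looks only at the present and the past, and a quantifier ranges only over the events
of the current session. List the sessions from the newest to the oldest: going back in time is then
removing the head of a list. Truth at the newest session obeys a recursion in which `prev` asks the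
tail, `since` unfolds to `ψ₂ ∨ (ψ₁ ∧ prev (since ψ₁ ψ₂))` (`holdsAt_since`), and `all` inspects the
events of one session. That the tail suffices for past instants is `holds_congr`. Each `since` or
`all` costs one loop with at most as many rounds as the input has symbols. The policy is fixed, so
the nesting depth of these loops is a constant and the evaluation is polynomial
(`PolyBool.holdsAt`). Constants and events are handled as strings; equality of events is equality of
strings by `evStr_injective`.

To make this a statement about machines, programs act on a stack of strings. `PolyStep orc r r'`
says that a single program turns the stack `r a` into `r' a` for all `a`, in time polynomial in the
size of `r a`. Such programs are closed under composition, case distinction and loops. Composition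
needs intermediate results of polynomial size; this holds because a machine pushes boundedly many
symbols per step (`PolyStep.size_le`). Loops need a state that grows by at most a constant per round
(`PolyStep.fold`).

The machines for the interpreted symbols become subroutines with their own stacks and memory
(`call_runs`). Only finitely many symbols occur in the policy, so the compound machine is finite.
`nonempty_computable` adds the reading of the input and the writing of the answer. -/

/-- `Steps M n c c'`: the machine `M` goes from `c` to `c'` in exactly `n` steps. -/
inductive Steps (M : Λ → TM2.Stmt Γ Λ σ) : ℕ → TM2.Cfg Γ Λ σ → TM2.Cfg Γ Λ σ → Prop
  | refl (c : TM2.Cfg Γ Λ σ) : Steps M 0 c c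
  | head {n : ℕ} {l : Λ} {v : σ} {S : ∀ k, List (Γ k)} {c : TM2.Cfg Γ Λ σ} :
      Steps M n (TM2.stepAux (M l) v S) c → Steps M (n + 1) ⟨some l, v, S⟩ c

theorem Steps.trans {M : Λ → TM2.Stmt Γ Λ σ} {m n : ℕ} {a b c : TM2.Cfg Γ Λ σ}
    (h : Steps M m a b) (h' : Steps M n b c) : Steps M (m + n) a c := by
  induction h with
  | refl => simpa using h'
  | @head k _ _ _ _ _ ih =>
    rw [show k + 1 + n = k + n + 1 by omega]
    exact .head (ih h')

/-- The right-hand side is the form of a run in the definition of computability. A halted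
configuration steps to `none`, and `none` stays `none`. -/
theorem steps_iff {M : Λ → TM2.Stmt Γ Λ σ} {n : ℕ} {a b : TM2.Cfg Γ Λ σ} :
    Steps M n a b ↔ (flip bind (TM2.step M))^[n] (some a) = some b := by
  induction n generalizing a with
  | zero =>
    constructor
    · rintro ⟨⟩; rfl
    · intro h
      cases h
      exact .refl _
  | succ n ih =>
    rw [Function.iterate_succ_apply]
    obtain ⟨_ | l, v, S⟩ := a
    · constructor
      · rintro ⟨⟩
      · intro h
        have : ∀ m, (flip bind (TM2.step M))^[m] none = none := fun m =>
          Function.iterate_fixed rfl m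
        exact absurd ((this n).symm.trans h) (by simp)
    · constructor
      · rintro ⟨⟩
        exact ih.1 ‹_›
      · exact fun h => .head (ih.2 h)

/-- Rename the labels of a statement. -/
def mapLabel (g : Λ → Λ') : TM2.Stmt Γ Λ σ → TM2.Stmt Γ Λ' σ
  | .push k f q => .push k f (mapLabel g q)
  | .peek k f q => .peek k f (mapLabel g q)
  | .pop k f q => .pop k f (mapLabel g q)
  | .load f q => .load f (mapLabel g q)
  | .branch p q q' => .branch p (mapLabel g q) (mapLabel g q')
  | .goto l => .goto fun v => g (l v)
  | .halt => .halt

theorem stepAux_mapLabel (g : Λ → Λ') (q : TM2.Stmt Γ Λ σ) (v : σ) (S : ∀ k, List (Γ k)) :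
    TM2.stepAux (mapLabel g q) v S =
      ⟨(TM2.stepAux q v S).l.map g, (TM2.stepAux q v S).var, (TM2.stepAux q v S).stk⟩ := by
  induction q generalizing v S with
  | branch p q q' ih ih' => cases h : p v <;> simp [mapLabel, h, ih, ih']
  | _ => simp [mapLabel, *]

/-- The number of push instructions in a statement. -/
def pushCount : TM2.Stmt Γ Λ σ → ℕ
  | .push _ _ q => pushCount q + 1
  | .peek _ _ q => pushCount q
  | .pop _ _ q => pushCount q
  | .load _ q => pushCount q
  | .branch _ q q' => pushCount q + pushCount q'
  | .goto _ => 0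
  | .halt => 0

theorem sum_length_update_le [Fintype K] (S : ∀ k, List (Γ k)) (k : K) (x : List (Γ k)) (c : ℕ)
    (hx : x.length ≤ (S k).length + c) :
    ∑ j, (Function.update S k x j).length ≤ ∑ j, (S j).length + c := by
  classical
  rw [← Finset.add_sum_erase _ _ (Finset.mem_univ k), ← Finset.add_sum_erase Finset.univ
    (fun j => (S j).length) (Finset.mem_univ k)]
  have : ∑ j ∈ Finset.univ.erase k, (Function.update S k x j).length =
      ∑ j ∈ Finset.univ.erase k, (S j).length :=
    Finset.sum_congr rfl fun j hj => by rw [Function.update_of_ne (Finset.ne_of_mem_erase hj)]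
  simp only [Function.update_self] at this ⊢
  omega

/-- A branch runs only one of its arms, so adding the counts of both is wasteful; all that matters
is a bound depending on the statement alone. -/
theorem sum_length_stepAux_le [Fintype K] (q : TM2.Stmt Γ Λ σ) (v : σ) (S : ∀ k, List (Γ k)) :
    ∑ j, ((TM2.stepAux q v S).stk j).length ≤ ∑ j, (S j).length + pushCount q := by
  induction q generalizing v S with
  | push k f q ih =>
    have := sum_length_update_le S k (f v :: S k) 1 (by simp)
    have := ih v (Function.update S k (f v :: S k))
    simp only [TM2.stepAux, pushCount] at *
    omega
  | pop k f q ih =>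
    have := sum_length_update_le S k (S k).tail 0 (by simp)
    have := ih (f v (S k).head?) (Function.update S k (S k).tail)
    simp only [TM2.stepAux, pushCount] at *
    omega
  | branch p q q' ih ih' =>
    have := ih v S
    have := ih' v S
    cases h : p v <;> simp only [TM2.stepAux, pushCount, h, cond_true, cond_false] at * <;> omega
  | peek k f q ih => exact ih _ _
  | load f q ih => exact ih _ _
  | goto => simp [pushCount]
  | halt => simp [pushCount]

theorem Steps.sum_length_le [Fintype K] {M : Λ → TM2.Stmt Γ Λ σ} {C : ℕ}
    (hC : ∀ l, pushCount (M l) ≤ C) {n : ℕ} {a b : TM2.Cfg Γ Λ σ} (h : Steps M n a b) :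
    ∑ j, (b.stk j).length ≤ ∑ j, (a.stk j).length + n * C := by
  induction h with
  | refl => simp
  | @head n l v S c _ ih =>
    have := sum_length_stepAux_le (M l) v S
    have := hC l
    have : (n + 1) * C = n * C + C := by ring
    dsimp only
    omega

/-! ### Structured programs: sequence, choice, loop -/

/-- A piece of a program, with one entry and one exit; the exit is the label `none`. -/
structure Frag (Γ : K → Type) (σ : Type) where
  /-- the labels -/
  Λ : Type
  fin : Finite Λ
  /-- the label where a run starts -/
  entry : Λ
  /-- the statements -/
  code : Λ → TM2.Stmt Γ (Option Λ) σ

/-- The machine that runs a fragment and halts after it has reached the exit. -/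
def Frag.prog (F : Frag Γ σ) : Option F.Λ → TM2.Stmt Γ (Option F.Λ) σ
  | none => .halt
  | some l => F.code l

/-- The fragment `F` goes in exactly `n` steps from its entry to its exit. -/
def Frag.Exec (F : Frag Γ σ) (n : ℕ) (v : σ) (S : ∀ k, List (Γ k)) (v' : σ)
    (S' : ∀ k, List (Γ k)) : Prop :=
  Steps F.prog n ⟨some (some F.entry), v, S⟩ ⟨some none, v', S'⟩

/-- Nothing is required of `M` at `g none`, so the exit may be glued to any label of the larger
program. Sequences, choices and loops are all obtained in this way. -/
theorem Steps.embed {F : Frag Γ σ} {M : Λ → TM2.Stmt Γ Λ σ} {g : Option F.Λ → Λ}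
    (hg : ∀ l, M (g (some l)) = mapLabel g (F.code l)) {n : ℕ} {a b : TM2.Cfg Γ (Option F.Λ) σ}
    (h : Steps F.prog n a b) (hb : b.l = some none) :
    Steps M n ⟨a.l.map g, a.var, a.stk⟩ ⟨some (g none), b.var, b.stk⟩ := by
  induction h with
  | refl => simpa [hb] using Steps.refl _
  | @head n l v S c h ih =>
    cases l with
    -- The exit executes `halt`, after which the label is `none` and no further step exists. A run
    -- that ends at the exit therefore cannot have met it earlier.
    | none =>
      cases h
      simp [Frag.prog] at hb
    | some l =>
      refine .head ?_
      rw [hg, stepAux_mapLabel]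
      exact ih hb

theorem Frag.Exec.embed {F : Frag Γ σ} {M : Λ → TM2.Stmt Γ Λ σ} {g : Option F.Λ → Λ}
    (hg : ∀ l, M (g (some l)) = mapLabel g (F.code l)) {n : ℕ} {v v' : σ}
    {S S' : ∀ k, List (Γ k)} (h : F.Exec n v S v' S') :
    Steps M n ⟨some (g (some F.entry)), v, S⟩ ⟨some (g none), v', S'⟩ :=
  Steps.embed hg h rfl

/-- Run `F`, then `G`. -/
def Frag.seq (F G : Frag Γ σ) : Frag Γ σ where
  Λ := F.Λ ⊕ G.Λ
  fin := by have := F.fin; have := G.fin; infer_instance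
  entry := .inl F.entry
  code
    | .inl l => mapLabel (fun o => some (o.elim (.inr G.entry) .inl)) (F.code l)
    | .inr l => mapLabel (Option.map .inr) (G.code l)

theorem Frag.Exec.seq {F G : Frag Γ σ} {m n : ℕ} {v v' v'' : σ} {S S' S'' : ∀ k, List (Γ k)}
    (hF : F.Exec m v S v' S') (hG : G.Exec n v' S' v'' S'') :
    (F.seq G).Exec (m + n) v S v'' S'' :=
  Steps.trans
    (hF.embed (M := (F.seq G).prog) (g := fun o => some (o.elim (.inr G.entry) .inl))
      fun _ => rfl)
    (hG.embed (M := (F.seq G).prog) (g := Option.map .inr) fun _ => rfl)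

/-- A fragment that consists of one statement. -/
def Frag.single (q : TM2.Stmt Γ (Option Unit) σ) : Frag Γ σ where
  Λ := Unit
  fin := inferInstance
  entry := ()
  code _ := q

/-- Run the statement `q`; where `q` goes to `some true`, run `F`, where it goes to `some false`,
run `G`. -/
def Frag.choice (q : TM2.Stmt Γ (Option Bool) σ) (F G : Frag Γ σ) : Frag Γ σ where
  Λ := Option (F.Λ ⊕ G.Λ)
  fin := by have := F.fin; have := G.fin; infer_instance
  entry := none
  code
    | none => mapLabel (Option.map fun b => some (bif b then .inl F.entry else .inr G.entry)) q
    | some (.inl l) => mapLabel (Option.map (some ∘ .inl)) (F.code l)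
    | some (.inr l) => mapLabel (Option.map (some ∘ .inr)) (G.code l)

theorem Frag.Exec.choice_true {q : TM2.Stmt Γ (Option Bool) σ} {F G : Frag Γ σ} {n : ℕ}
    {v v' v'' : σ} {S S' S'' : ∀ k, List (Γ k)}
    (hq : TM2.stepAux q v S = ⟨some (some true), v', S'⟩) (hF : F.Exec n v' S' v'' S'') :
    (Frag.choice q F G).Exec (n + 1) v S v'' S'' := by
  refine .head ?_
  have := hF.embed (M := (Frag.choice q F G).prog) (g := Option.map (some ∘ .inl)) fun _ => rfl
  simpa [Frag.prog, Frag.choice, stepAux_mapLabel, hq] using this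

theorem Frag.Exec.choice_false {q : TM2.Stmt Γ (Option Bool) σ} {F G : Frag Γ σ} {n : ℕ}
    {v v' v'' : σ} {S S' S'' : ∀ k, List (Γ k)}
    (hq : TM2.stepAux q v S = ⟨some (some false), v', S'⟩) (hG : G.Exec n v' S' v'' S'') :
    (Frag.choice q F G).Exec (n + 1) v S v'' S'' := by
  refine .head ?_
  have := hG.embed (M := (Frag.choice q F G).prog) (g := Option.map (some ∘ .inr)) fun _ => rfl
  simpa [Frag.prog, Frag.choice, stepAux_mapLabel, hq] using this

/-- Run the statement `q`; where `q` goes to `some ()`, run `F` and repeat. -/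
def Frag.loop (q : TM2.Stmt Γ (Option Unit) σ) (F : Frag Γ σ) : Frag Γ σ where
  Λ := Option F.Λ
  fin := by have := F.fin; infer_instance
  entry := none
  code
    | none => mapLabel (Option.map fun _ => some F.entry) q
    | some l => mapLabel some (F.code l)

theorem Frag.Exec.loop_exit {q : TM2.Stmt Γ (Option Unit) σ} {F : Frag Γ σ}
    {v v' : σ} {S S' : ∀ k, List (Γ k)} (hq : TM2.stepAux q v S = ⟨some none, v', S'⟩) :
    (Frag.loop q F).Exec 1 v S v' S' := by
  refine .head ?_
  simpa [Frag.prog, Frag.loop, stepAux_mapLabel, hq] using Steps.refl _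

theorem Frag.Exec.loop_next {q : TM2.Stmt Γ (Option Unit) σ} {F : Frag Γ σ} {m n : ℕ}
    {v v' v'' w : σ} {S S' S'' T : ∀ k, List (Γ k)}
    (hq : TM2.stepAux q v S = ⟨some (some ()), v', S'⟩) (hF : F.Exec m v' S' v'' S'')
    (hL : (Frag.loop q F).Exec n v'' S'' w T) :
    (Frag.loop q F).Exec (m + n + 1) v S w T := by
  refine .head ?_
  have := (hF.embed (M := (Frag.loop q F).prog) (g := some) fun _ => rfl).trans hL
  simpa [Frag.prog, Frag.loop, stepAux_mapLabel, hq] using this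

omit [DecidableEq K] in
theorem Frag.exists_pushCount_le (F : Frag Γ σ) : ∃ C, ∀ l, pushCount (F.prog l) ≤ C := by
  have := F.fin
  obtain ⟨C, hC⟩ := (Set.finite_range fun l => pushCount (F.prog l)).bddAbove
  exact ⟨C, fun l => hC ⟨l, rfl⟩⟩

end Machine

/-! ### Machines with a stack of strings and oracles -/

/-- The values that programs compute with. -/
abbrev Str : Type := List Γ'

/-- The registers: the data stack and two auxiliary stacks. -/
inductive Reg
  | data
  | aux
  | tmp
  deriving DecidableEq

instance : Finite Reg :=
  Finite.of_injective (fun r : Reg => (match r with | .data => 0 | .aux => 1 | .tmp => 2 : Fin 3))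
    fun a b h => by cases a <;> cases b <;> first | rfl | simp at h

noncomputable section

variable {O : Type} (orc : O → TM2ComputableAux Γ' Bool)

/-- The stacks of a machine with oracles: registers, input, output, and the stacks of the
oracles. -/
inductive Stk
  | reg (r : Reg)
  | inp
  | out
  | sub (o : O) (k : (orc o).tm.K)

/-- The stack alphabets. In a register, `none` marks the end of a string. -/
abbrev Alph : Stk orc → Type
  | .reg _ => Option Γ'
  | .inp => Γ'
  | .out => Bool
  | .sub o k => (orc o).tm.Γ k

/-- The memory consists of the last symbol that was read and the memories of the oracles. -/
abbrev Mem : Type := Option Γ' × ∀ o, (orc o).tm.σ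

instance : DecidableEq (Stk orc) := Classical.decEq _

instance [Finite O] : Finite (Stk orc) := by
  have (o : O) : Finite (orc o).tm.K := (orc o).tm.kFin.finite
  refine Finite.of_injective (β := (Reg ⊕ Bool) ⊕ (Σ o, (orc o).tm.K)) (fun k => match k with
    | .reg r => .inl (.inl r)
    | .inp => .inl (.inr true)
    | .out => .inl (.inr false)
    | .sub o k => .inr ⟨o, k⟩) ?_
  rintro (_ | _ | _ | _) (_ | _ | _ | _) <;> simp

instance [Finite O] : Fintype (Stk orc) := Fintype.ofFinite _

instance [Finite O] : Finite (Mem orc) := by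
  have (o : O) : Finite (orc o).tm.σ := (orc o).tm.σFin.finite
  infer_instance

/-- The memory between two instructions. -/
def idle : Mem orc := (none, fun o => (orc o).tm.initialState)

/-- A stack of strings, written on a register. -/
def encode (s : List Str) : List (Option Γ') := s.flatMap fun v => v.map some ++ [none]

@[simp] theorem encode_nil : encode [] = [] := rfl

@[simp] theorem encode_cons (v : Str) (s : List Str) :
    encode (v :: s) = v.map some ++ none :: encode s := by simp [encode]

/-- The stacks between two instructions. -/
def stackOf (R : Reg → List Str) : (k : Stk orc) → List (Alph orc k)
  | .reg r => encode (R r)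
  | .inp => []
  | .out => []
  | .sub _ _ => []

/-- The contents of the registers. -/
def regs (d t u : List Str) : Reg → List Str
  | .data => d
  | .aux => t
  | .tmp => u

@[simp] theorem regs_data (d t u : List Str) : regs d t u .data = d := rfl
@[simp] theorem regs_aux (d t u : List Str) : regs d t u .aux = t := rfl
@[simp] theorem regs_tmp (d t u : List Str) : regs d t u .tmp = u := rfl

@[simp] theorem update_regs_data (d t u x : List Str) :
    Function.update (regs d t u) .data x = regs x t u := by
  funext r; cases r <;> rfl

@[simp] theorem update_regs_aux (d t u x : List Str) :
    Function.update (regs d t u) .aux x = regs d x u := by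
  funext r; cases r <;> rfl

@[simp] theorem update_regs_tmp (d t u x : List Str) :
    Function.update (regs d t u) .tmp x = regs d t x := by
  funext r; cases r <;> rfl

variable {orc}

theorem stackOf_update (R : Reg → List Str) (r : Reg) (x : List Str) :
    stackOf orc (Function.update R r x) = Function.update (stackOf orc R) (.reg r) (encode x) := by
  funext k
  by_cases h : k = .reg r
  · subst h; simp [stackOf]
  · rw [Function.update_of_ne h]
    cases k with
    | reg r' =>
      have : r' ≠ r := fun e => h (e ▸ rfl)
      simp [stackOf, this]
    | _ => rfl

@[simp] theorem stackOf_reg (R : Reg → List Str) (r : Reg) :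
    stackOf orc R (.reg r) = encode (R r) := rfl

/-- A piece of a program of a machine with oracles. -/
abbrev Piece (orc : O → TM2ComputableAux Γ' Bool) : Type 1 := Frag (Alph orc) (Mem orc)

/-- `F` changes the stacks from `S` to `S'` in at most `n` steps. -/
def Piece.Does (F : Piece orc) (n : ℕ) (S S' : (k : Stk orc) → List (Alph orc k)) : Prop :=
  ∃ m ≤ n, F.Exec m (idle orc) S (idle orc) S'

/-- `F` changes the registers from `R` to `R'` in at most `n` steps. -/
def Piece.Runs (F : Piece orc) (n : ℕ) (R R' : Reg → List Str) : Prop :=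
  F.Does n (stackOf orc R) (stackOf orc R')

theorem Piece.Does.mono {F : Piece orc} {m n : ℕ} {S S' : (k : Stk orc) → List (Alph orc k)}
    (h : F.Does m S S') (hmn : m ≤ n) : F.Does n S S' :=
  let ⟨k, hk, e⟩ := h
  ⟨k, hk.trans hmn, e⟩

theorem Piece.Does.seq {F G : Piece orc} {m n : ℕ} {S S' S'' : (k : Stk orc) → List (Alph orc k)}
    (h : F.Does m S S') (h' : G.Does n S' S'') : Piece.Does (F.seq G) (m + n) S S'' :=
  let ⟨k, hk, e⟩ := h
  let ⟨k', hk', e'⟩ := h'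
  ⟨k + k', by omega, e.seq e'⟩

/-- Push the last symbol that was read on the stacks `ds`. -/
def pushAll (ds : List (Σ k : Stk orc, Γ' → Alph orc k)) (q : TM2.Stmt (Alph orc) (Option Unit) (Mem orc)) :
    TM2.Stmt (Alph orc) (Option Unit) (Mem orc) :=
  ds.foldr (fun d q => .push d.1 (fun v => d.2 (v.1.getD .blank)) q) q

/-- The effect of pushing the symbol `c` on the stacks `ds`. -/
def pushed (ds : List (Σ k : Stk orc, Γ' → Alph orc k)) (S : (k : Stk orc) → List (Alph orc k)) (c : Γ') :
    (k : Stk orc) → List (Alph orc k) :=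
  ds.foldl (fun S d => Function.update S d.1 (d.2 c :: S d.1)) S

theorem stepAux_pushAll (ds : List (Σ k : Stk orc, Γ' → Alph orc k))
    (q : TM2.Stmt (Alph orc) (Option Unit) (Mem orc)) (v : Mem orc)
    (S : (k : Stk orc) → List (Alph orc k)) :
    TM2.stepAux (pushAll ds q) v S = TM2.stepAux q v (pushed ds S (v.1.getD .blank)) := by
  induction ds generalizing S with
  | nil => rfl
  | cons d ds ih => exact ih _

theorem pushed_apply {ds : List (Σ k : Stk orc, Γ' → Alph orc k)} {k : Stk orc}
    (h : ∀ d ∈ ds, d.1 ≠ k) (S : (k : Stk orc) → List (Alph orc k)) (c : Γ') :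
    pushed ds S c k = S k := by
  induction ds generalizing S with
  | nil => rfl
  | cons d ds ih =>
    refine (ih (fun e he => h e (List.mem_cons_of_mem _ he)) _).trans ?_
    exact Function.update_of_ne (h d List.mem_cons_self).symm _ _

theorem pushed_update {ds : List (Σ k : Stk orc, Γ' → Alph orc k)} {k : Stk orc}
    (h : ∀ d ∈ ds, d.1 ≠ k) (S : (k : Stk orc) → List (Alph orc k)) (c : Γ')
    (x : List (Alph orc k)) :
    pushed ds (Function.update S k x) c = Function.update (pushed ds S c) k x := by
  induction ds generalizing S with
  | nil => rfl
  | cons d ds ih =>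
    have hd := h d List.mem_cons_self
    refine Eq.trans ?_ (ih (fun e he => h e (List.mem_cons_of_mem _ he)) _)
    simp only [pushed, List.foldl_cons]
    rw [Function.update_of_ne hd, Function.update_comm hd.symm]

/-- Move symbols from the stack `src` to the stacks `ds`, up to an end marker, which is removed. -/
def pump (src : Stk orc) (rd : Alph orc src → Option Γ')
    (ds : List (Σ k : Stk orc, Γ' → Alph orc k)) : Piece orc :=
  .loop (.pop src (fun v c => (c.bind rd, v.2)) <|
    .branch (fun v => v.1.isSome) (pushAll ds <| .load (fun v => (none, v.2)) <|
      .goto fun _ => some ()) (.goto fun _ => none)) (.single <| .goto fun _ => none)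

/-- Each symbol costs two steps: the test statement of the loop transfers it, and the loop body is a
bare jump. The rest `y` starts with an end marker or is empty; the latter covers stacks without
markers, such as the input and the output stack of an oracle. -/
theorem pump_does {src : Stk orc} {rd : Alph orc src → Option Γ'}
    {ds : List (Σ k : Stk orc, Γ' → Alph orc k)} (h : ∀ d ∈ ds, d.1 ≠ src) (l : Str)
    (x y : List (Alph orc src)) (hx : x.map rd = l.map some) (hy : y.head?.bind rd = none)
    (S : (k : Stk orc) → List (Alph orc k)) (hS : S src = x ++ y) :
    (pump src rd ds).Does (2 * l.length + 1) S
      (Function.update (l.foldl (pushed ds) S) src y.tail) := by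
  refine ⟨2 * l.length + 1, le_rfl, ?_⟩
  induction l generalizing S x with
  | nil =>
    obtain rfl : x = [] := by simpa using hx
    refine Frag.Exec.loop_exit ?_
    rw [List.nil_append] at hS
    simp [idle, hS, hy]
  | cons c l ih =>
    obtain ⟨a, x, rfl, ha, hx⟩ : ∃ a x', x = a :: x' ∧ rd a = some c ∧ x'.map rd = l.map some := by
      cases x with
      | nil => simp at hx
      | cons a x => exact ⟨a, x, rfl, by simpa using hx⟩
    have hstep := ih x hx (pushed ds (Function.update S src (x ++ y)) c) (by
      rw [pushed_apply h]; simp)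
    rw [pushed_update h] at hstep
    -- No destination equals `src`, so overwriting `src` commutes with all later pushes and only its
    -- final content counts.
    have hcomm : ∀ (l : Str) (S : (k : Stk orc) → List (Alph orc k)) z,
        l.foldl (pushed ds) (Function.update S src z) =
          Function.update (l.foldl (pushed ds) S) src z := by
      intro l
      induction l with
      | nil => intros; rfl
      | cons c l ih =>
        intro S z
        rw [List.foldl_cons, pushed_update h, ih, List.foldl_cons]
    rw [hcomm, Function.update_idem] at hstep
    rw [show 2 * (c :: l).length + 1 = 1 + (2 * l.length + 1) + 1 by simp; ring]
    refine Frag.Exec.loop_next (v' := idle orc) (S' := pushed ds (Function.update S src (x ++ y)) c)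
      ?_ (.head (.refl _)) ?_
    · simp [idle, hS, ha, stepAux_pushAll]
    · rw [pushed_update h]
      exact hstep

end

noncomputable section

variable {O : Type} {orc : O → TM2ComputableAux Γ' Bool}

theorem Piece.Does.congr {F : Piece orc} {m n : ℕ} {S S' T T' : (k : Stk orc) → List (Alph orc k)}
    (h : F.Does m S S') (hmn : m ≤ n) (hS : S = T) (hS' : S' = T') : F.Does n T T' := by
  subst hS hS'
  exact h.mono hmn

theorem foldl_pushed_singleton (k : Stk orc) (w : Γ' → Alph orc k) (l : Str)
    (S : (k : Stk orc) → List (Alph orc k)) :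
    l.foldl (pushed [⟨k, w⟩]) S = Function.update S k ((l.map w).reverse ++ S k) := by
  induction l generalizing S with
  | nil => simp
  | cons c l ih => simp [ih, pushed]

theorem foldl_pushed_pair {k k' : Stk orc} (h : k ≠ k') (w : Γ' → Alph orc k)
    (w' : Γ' → Alph orc k') (l : Str) (S : (k : Stk orc) → List (Alph orc k)) :
    l.foldl (pushed [⟨k, w⟩, ⟨k', w'⟩]) S = Function.update
      (Function.update S k ((l.map w).reverse ++ S k)) k' ((l.map w').reverse ++ S k') := by
  induction l generalizing S with
  | nil => simp
  | cons c l ih =>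
    simp only [List.foldl_cons, ih, pushed, List.foldl_nil, Function.update_of_ne h.symm,
      Function.update_self, Function.update_of_ne h, List.map_cons, List.reverse_cons,
      List.append_assoc, List.singleton_append]
    rw [Function.update_comm h.symm, Function.update_idem, Function.update_idem]

theorem single_does {q : TM2.Stmt (Alph orc) (Option Unit) (Mem orc)}
    {S S' : (k : Stk orc) → List (Alph orc k)}
    (h : TM2.stepAux q (idle orc) S = ⟨some none, idle orc, S'⟩) :
    Piece.Does (.single q) 1 S S' :=
  ⟨1, le_rfl, .head (by simpa [Frag.prog, Frag.single, h] using Steps.refl _)⟩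

/-! ### Basic instructions on registers -/

/-- Push an empty string on a register. -/
def pushEmpty (r : Reg) : Piece orc := .single (.push (.reg r) (fun _ => none) (.goto fun _ => none))

theorem pushEmpty_runs (r : Reg) (R : Reg → List Str) :
    (pushEmpty (orc := orc) r).Runs 1 R (Function.update R r ([] :: R r)) :=
  single_does (by simp [stackOf_update])

/-- Put a symbol in front of the top string of the data stack. -/
def consTop (c : Γ') : Piece orc :=
  .single (.push (.reg .data) (fun _ => some c) (.goto fun _ => none))

theorem consTop_runs (c : Γ') (v : Str) (d t u : List Str) :
    (consTop (orc := orc) c).Runs 1 (regs (v :: d) t u) (regs ((c :: v) :: d) t u) := by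
  refine single_does ?_
  rw [← update_regs_data (v :: d) t u ((c :: v) :: d), stackOf_update]
  simp

/-- Remove the first symbol of the top string of the data stack. -/
def tailTop : Piece orc :=
  .single (.pop (.reg .data) (fun v c => (c.join, v.2)) <|
    .branch (fun v => v.1.isSome) (.load (fun v => (none, v.2)) <| .goto fun _ => none)
      (.push (.reg .data) (fun _ => none) <| .goto fun _ => none))

theorem tailTop_runs (v : Str) (d t u : List Str) :
    (tailTop (orc := orc)).Runs 1 (regs (v :: d) t u) (regs (v.tail :: d) t u) := by
  refine single_does ?_
  rw [← update_regs_data (v :: d) t u (v.tail :: d), stackOf_update]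
  cases v <;> simp [idle]

/-- Remove the top string of a register. -/
def dropTop (r : Reg) : Piece orc := pump (.reg r) id []

theorem dropTop_runs {r : Reg} {R : Reg → List Str} {v : Str} {s : List Str} (h : R r = v :: s) :
    (dropTop (orc := orc) r).Runs (2 * v.length + 1) R (Function.update R r s) := by
  have := pump_does (orc := orc) (src := .reg r) (rd := id) (ds := []) (by simp) v
    (v.map some) (none :: encode s) (by simp) rfl (stackOf orc R) (by simp [h])
  have hf : ∀ (l : Str) S, l.foldl (pushed (orc := orc) []) S = S := fun l S => by
    induction l generalizing S with
    | nil => rfl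
    | cons c l ih => exact ih S
  rw [hf] at this
  rw [Piece.Runs, stackOf_update]
  exact this

/-- Move the top string of a register to another one, and reverse it. -/
def move (r r' : Reg) : Piece orc := (pushEmpty r').seq (pump (.reg r) id [⟨.reg r', some⟩])

theorem move_runs {r r' : Reg} (hr : r ≠ r') {R : Reg → List Str} {v : Str} {s : List Str}
    (h : R r = v :: s) :
    (move (orc := orc) r r').Runs (2 * v.length + 2) R
      (Function.update (Function.update R r' (v.reverse :: R r')) r s) := by
  have hr' : (Stk.reg r' : Stk orc) ≠ .reg r := fun e => hr (by cases e; rfl)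
  have := (pushEmpty_runs (orc := orc) r' R).seq <|
    pump_does (orc := orc) (src := .reg r) (rd := id) (ds := [⟨.reg r', some⟩])
    (by simpa using hr') v (v.map some) (none :: encode s) (by simp) rfl
    (stackOf orc (Function.update R r' ([] :: R r'))) (by simp [Function.update_of_ne hr, h])
  rw [foldl_pushed_singleton] at this
  refine this.congr (by omega) rfl ?_
  rw [stackOf_update, stackOf_update, stackOf_update, Function.update_idem]
  simp

/-- Move the top string of a register to two others, and reverse it. -/
def copy (r r' r'' : Reg) : Piece orc :=
  (pushEmpty r').seq ((pushEmpty r'').seq (pump (.reg r) id [⟨.reg r', some⟩, ⟨.reg r'', some⟩]))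

theorem copy_runs {r r' r'' : Reg} (hr : r ≠ r') (hr' : r ≠ r'') (hr'' : r' ≠ r'')
    {R : Reg → List Str} {v : Str} {s : List Str} (h : R r = v :: s) :
    (copy (orc := orc) r r' r'').Runs (2 * v.length + 3) R
      (Function.update (Function.update (Function.update R r' (v.reverse :: R r')) r''
        (v.reverse :: R r'')) r s) := by
  have h1 : (Stk.reg r' : Stk orc) ≠ .reg r := fun e => hr (by cases e; rfl)
  have h2 : (Stk.reg r'' : Stk orc) ≠ .reg r := fun e => hr' (by cases e; rfl)
  have h3 : (Stk.reg r' : Stk orc) ≠ .reg r'' := fun e => hr'' (by cases e; rfl)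
  have := (pushEmpty_runs (orc := orc) r' R).seq <| (pushEmpty_runs (orc := orc) r'' _).seq <|
    pump_does (orc := orc) (src := .reg r) (rd := id) (ds := [⟨.reg r', some⟩, ⟨.reg r'', some⟩])
    (by simp [h1, h2]) v (v.map some) (none :: encode s) (by simp) rfl
    (stackOf orc (Function.update (Function.update R r' ([] :: R r')) r''
      ([] :: Function.update R r' ([] :: R r') r'')))
    (by simp [Function.update_of_ne hr, Function.update_of_ne hr', h])
  rw [foldl_pushed_pair h3] at this
  refine this.congr (by omega) rfl ?_
  rw [Function.update_of_ne hr''.symm, stackOf_update, stackOf_update, stackOf_update,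
    stackOf_update, stackOf_update, Function.update_comm h3.symm, Function.update_idem,
    Function.update_idem]
  simp [Function.update_of_ne h3]

/-! ### Oracle calls -/

section Sub

open Classical in
/-- Replace the stacks of the oracle `o`. -/
def withSub (S : (k : Stk orc) → List (Alph orc k)) (o : O) (T : ∀ k, List ((orc o).tm.Γ k)) :
    (k : Stk orc) → List (Alph orc k)
  | .sub o' k => if h : o = o' then
      (h ▸ T : ∀ k : (orc o').tm.K, List ((orc o').tm.Γ k)) k else S (.sub o' k)
  | .reg r => S (.reg r)
  | .inp => S .inp
  | .out => S .out

@[simp] theorem withSub_sub (S : (k : Stk orc) → List (Alph orc k)) (o : O)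
    (T : ∀ k, List ((orc o).tm.Γ k)) (k : (orc o).tm.K) : withSub S o T (.sub o k) = T k := by
  simp [withSub]

@[simp] theorem withSub_reg (S : (k : Stk orc) → List (Alph orc k)) (o : O)
    (T : ∀ k, List ((orc o).tm.Γ k)) (r : Reg) : withSub S o T (.reg r) = S (.reg r) := rfl

theorem update_withSub (S : (k : Stk orc) → List (Alph orc k)) (o : O)
    (T : ∀ k, List ((orc o).tm.Γ k)) (k : (orc o).tm.K) (x : List ((orc o).tm.Γ k)) :
    Function.update (withSub S o T) (.sub o k) x = withSub S o (Function.update T k x) := by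
  funext j
  by_cases hj : j = .sub o k
  · subst hj; simp
  · rw [Function.update_of_ne hj]
    cases j with
    | sub o' k' =>
      by_cases h : o = o'
      · subst h
        have : k' ≠ k := fun e => hj (e ▸ rfl)
        simp [this]
      · simp [withSub, h]
    | _ => rfl

theorem update_withSub_reg (S : (k : Stk orc) → List (Alph orc k)) (o : O)
    (T : ∀ k, List ((orc o).tm.Γ k)) (r : Reg) (x : List (Option Γ')) :
    Function.update (withSub S o T) (.reg r) x = withSub (Function.update S (.reg r) x) o T := by
  funext j
  by_cases hj : j = .reg r
  · subst hj; simp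
  · rw [Function.update_of_ne hj]
    cases j with
    | reg r' => simp [Function.update_of_ne hj]
    | _ => simp [withSub]

theorem withSub_stackOf (R : Reg → List Str) (o : O) :
    withSub (stackOf orc R) o (fun _ => []) = stackOf orc R := by
  funext j
  cases j with
  | sub o' k' =>
    by_cases h : o = o'
    · subst h; simp [stackOf]
    · simp [withSub, h]
  | _ => rfl

open Classical in
/-- Statements of an oracle as statements of the whole machine. -/
def subStmt (o : O) : TM2.Stmt (orc o).tm.Γ (orc o).tm.Λ (orc o).tm.σ →
    TM2.Stmt (Alph orc) (Option (orc o).tm.Λ) (Mem orc)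
  | .push k f q => .push (.sub o k) (fun v => f (v.2 o)) (subStmt o q)
  | .peek k f q => .peek (.sub o k) (fun v c => (v.1, Function.update v.2 o (f (v.2 o) c)))
      (subStmt o q)
  | .pop k f q => .pop (.sub o k) (fun v c => (v.1, Function.update v.2 o (f (v.2 o) c)))
      (subStmt o q)
  | .load f q => .load (fun v => (v.1, Function.update v.2 o (f (v.2 o)))) (subStmt o q)
  | .branch p q q' => .branch (fun v => p (v.2 o)) (subStmt o q) (subStmt o q')
  | .goto l => .goto fun v => some (l (v.2 o))
  | .halt => .goto fun _ => none

-- A translated statement touches only the oracle's own stacks and its own component of the memory.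
-- The label `none` of a halted oracle becomes the exit of the piece.
open Classical in
theorem stepAux_subStmt (o : O) (q : TM2.Stmt (orc o).tm.Γ (orc o).tm.Λ (orc o).tm.σ)
    (c : Option Γ') (m : ∀ o, (orc o).tm.σ) (w : (orc o).tm.σ)
    (S : (k : Stk orc) → List (Alph orc k)) (T : ∀ k, List ((orc o).tm.Γ k)) :
    TM2.stepAux (subStmt o q) (c, Function.update m o w) (withSub S o T) =
      ⟨some (TM2.stepAux q w T).l, (c, Function.update m o (TM2.stepAux q w T).var),
        withSub S o (TM2.stepAux q w T).stk⟩ := by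
  induction q generalizing w T with
  | branch p q q' ih ih' => cases h : p w <;> simp [subStmt, h, ih, ih']
  | push k f q ih => simp [subStmt, update_withSub, ih]
  | pop k f q ih => simp [subStmt, update_withSub, ih]
  | _ => simp [subStmt, *]

/-- The oracle `o` as a part of the whole machine. -/
def subPiece (o : O) : Piece orc where
  Λ := (orc o).tm.Λ
  fin := (orc o).tm.ΛFin.finite
  entry := (orc o).tm.main
  code l := subStmt o ((orc o).tm.m l)

open Classical in
theorem subPiece_steps {o : O} {n : ℕ} {a b : TM2.Cfg (orc o).tm.Γ (orc o).tm.Λ (orc o).tm.σ}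
    (h : Steps (orc o).tm.m n a b) (hb : b.l = none) (c : Option Γ') (m : ∀ o, (orc o).tm.σ)
    (S : (k : Stk orc) → List (Alph orc k)) :
    Steps (subPiece o).prog n ⟨some a.l, (c, Function.update m o a.var), withSub S o a.stk⟩
      ⟨some none, (c, Function.update m o b.var), withSub S o b.stk⟩ := by
  induction h with
  | refl => rw [hb]; exact .refl _
  | @head n l v T c' _ ih =>
    refine .head ?_
    exact (stepAux_subStmt o ((orc o).tm.m l) c m v S T).symm ▸ ih hb

theorem initList_eq (tm : FinTM2) (s : List (tm.Γ tm.k₀)) :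
    initList tm s = ⟨some tm.main, tm.initialState, Function.update (fun _ => []) tm.k₀ s⟩ := by
  unfold initList
  congr 1
  funext k
  by_cases h : k = tm.k₀
  · subst h; simp
  · simp [h]

theorem haltList_eq (tm : FinTM2) (s : List (tm.Γ tm.k₁)) :
    haltList tm s = ⟨none, tm.initialState, Function.update (fun _ => []) tm.k₁ s⟩ := by
  unfold haltList
  congr 1
  funext k
  by_cases h : k = tm.k₁
  · subst h; simp
  · simp [h]

-- An oracle halts in its initial memory with every stack empty except the output stack. Once the
-- answer has been removed it is ready for the next call.
open Classical in
theorem subPiece_does {o : O} {n : ℕ} {v : List ((orc o).tm.Γ (orc o).tm.k₀)}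
    {l : List ((orc o).tm.Γ (orc o).tm.k₁)}
    (h : Steps (orc o).tm.m n (initList (orc o).tm v) (haltList (orc o).tm l))
    (S : (k : Stk orc) → List (Alph orc k)) :
    (subPiece o).Does n (withSub S o (Function.update (fun _ => []) (orc o).tm.k₀ v))
      (withSub S o (Function.update (fun _ => []) (orc o).tm.k₁ l)) := by
  rw [initList_eq, haltList_eq] at h
  have := subPiece_steps h rfl none (idle orc).2 S
  have e : Function.update (idle orc).2 o (orc o).tm.initialState = (idle orc).2 :=
    Function.update_eq_self o (idle orc).2
  dsimp only at this
  rw [e] at this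
  exact ⟨n, le_rfl, this⟩

/-- Replace the top string of the data stack by the answer of the oracle `o`. -/
def call (o : O) : Piece orc :=
  (move .data .aux).seq <|
  (pump (.reg .aux) id [⟨.sub o (orc o).tm.k₀, (orc o).inputAlphabet.symm⟩]).seq <|
  (subPiece o).seq <|
  Frag.seq (.single (.push (.reg .tmp) (fun _ => none) (.goto fun _ => none))) <|
  (pump (.sub o (orc o).tm.k₁) (fun b => some (.bit ((orc o).outputAlphabet b)))
    [⟨.reg .tmp, some⟩]).seq <|
  move .tmp .data

/-- Every transfer between stacks reverses a string. The argument passes through `aux` and the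
answer through `tmp`, so each is reversed twice and arrives in the right order. -/
theorem call_runs {o : O} {n : ℕ} {v : Str} {l : List Bool}
    (h : Steps (orc o).tm.m n (initList (orc o).tm (v.map (orc o).inputAlphabet.symm))
      (haltList (orc o).tm (l.map (orc o).outputAlphabet.symm))) (d t u : List Str) :
    (call (orc := orc) o).Runs (4 * v.length + 4 * l.length + n + 7) (regs (v :: d) t u)
      (regs (l.map .bit :: d) t u) := by
  have h1 := move_runs (orc := orc) (r := .data) (r' := .aux) (by simp)
    (R := regs (v :: d) t u) rfl
  simp only [regs_aux, update_regs_aux, update_regs_data] at h1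
  have h2 := pump_does (orc := orc) (src := .reg .aux) (rd := id)
    (ds := [⟨.sub o (orc o).tm.k₀, (orc o).inputAlphabet.symm⟩]) (by simp) v.reverse
    (v.reverse.map some) (none :: encode t) (by simp) rfl (stackOf orc (regs d (v.reverse :: t) u))
    (by simp)
  have h3 := subPiece_does h (stackOf orc (regs d t u))
  have h4 := single_does (orc := orc) (q := .push (.reg .tmp) (fun _ => none) (.goto fun _ => none))
    (S := withSub (stackOf orc (regs d t u)) o
      (Function.update (fun _ => []) (orc o).tm.k₁ (l.map (orc o).outputAlphabet.symm)))
    (S' := withSub (stackOf orc (regs d t ([] :: u))) o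
      (Function.update (fun _ => []) (orc o).tm.k₁ (l.map (orc o).outputAlphabet.symm)))
    (by
      rw [← update_regs_tmp d t u ([] :: u), stackOf_update, ← update_withSub_reg]
      simp)
  have h5 := pump_does (orc := orc) (src := .sub o (orc o).tm.k₁)
    (rd := fun b => some (.bit ((orc o).outputAlphabet b)))
    (ds := [⟨.reg .tmp, some⟩]) (by simp) (l.map .bit)
    (l.map (orc o).outputAlphabet.symm) [] (by simp) rfl
    (withSub (stackOf orc (regs d t ([] :: u))) o
      (Function.update (fun _ => []) (orc o).tm.k₁ (l.map (orc o).outputAlphabet.symm)))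
    (by simp)
  have h6 := move_runs (orc := orc) (r := .tmp) (r' := .data) (by simp)
    (R := regs d t ((l.map .bit).reverse :: u)) rfl
  simp only [regs_data, update_regs_data, update_regs_tmp, List.reverse_reverse] at h6
  rw [foldl_pushed_singleton] at h2 h5
  have e2 : Function.update (Function.update (stackOf orc (regs d (v.reverse :: t) u))
      (.sub o (orc o).tm.k₀) (v.map (orc o).inputAlphabet.symm)) (.reg .aux) (encode t) =
      withSub (stackOf orc (regs d t u)) o
        (Function.update (fun _ => []) (orc o).tm.k₀ (v.map (orc o).inputAlphabet.symm)) := by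
    rw [← withSub_stackOf _ o, update_withSub, update_withSub_reg, ← stackOf_update,
      update_regs_aux]
  have e5 : Function.update (Function.update (withSub (stackOf orc (regs d t ([] :: u))) o
      (Function.update (fun _ => []) (orc o).tm.k₁ (l.map (orc o).outputAlphabet.symm)))
      (.reg .tmp) (encode ((l.map .bit).reverse :: u))) (.sub o (orc o).tm.k₁) [] =
      stackOf orc (regs d t ((l.map .bit).reverse :: u)) := by
    rw [update_withSub_reg, ← stackOf_update, update_regs_tmp, update_withSub,
      Function.update_idem, Function.update_eq_self (f := fun _ => []), withSub_stackOf]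
  refine (h1.seq <| Piece.Does.seq (h2.congr le_rfl rfl ?_) <| h3.seq <| h4.seq <|
    Piece.Does.seq (h5.congr le_rfl rfl ?_) h6).congr (n := 4 * v.length + 4 * l.length + n + 7)
    ?_ rfl rfl
  · rw [← e2]
    simp [stackOf]
  · rw [← e5]
    simp
  · simp
    omega

end Sub

end

/-! ### Polynomial bounds -/

/-- Natural coefficients make polynomials monotone, which is what allows bounds to be composed. -/
theorem eval_mono (p : Polynomial ℕ) {m n : ℕ} (h : m ≤ n) : p.eval m ≤ p.eval n := by
  rw [Polynomial.eval_eq_sum, Polynomial.eval_eq_sum]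
  exact Finset.sum_le_sum fun i _ => Nat.mul_le_mul_left _ (Nat.pow_le_pow_left h i)

/-- `f` is bounded by a polynomial in `g`. -/
def PolyLe {α : Type} (f g : α → ℕ) : Prop := ∃ p : Polynomial ℕ, ∀ a, f a ≤ p.eval (g a)

namespace PolyLe

variable {α : Type} {f f' g k : α → ℕ}

theorem of_le (h : ∀ a, f a ≤ g a) : PolyLe f g := ⟨.X, by simpa using h⟩

theorem const (c : ℕ) : PolyLe (fun _ => c) g := ⟨.C c, by simp⟩

theorem add (h : PolyLe f g) (h' : PolyLe f' g) : PolyLe (fun a => f a + f' a) g := by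
  obtain ⟨p, hp⟩ := h
  obtain ⟨q, hq⟩ := h'
  exact ⟨p + q, fun a => by simpa using add_le_add (hp a) (hq a)⟩

theorem mul (h : PolyLe f g) (h' : PolyLe f' g) : PolyLe (fun a => f a * f' a) g := by
  obtain ⟨p, hp⟩ := h
  obtain ⟨q, hq⟩ := h'
  exact ⟨p * q, fun a => by simpa using Nat.mul_le_mul (hp a) (hq a)⟩

theorem trans (h : PolyLe f g) (h' : PolyLe g k) : PolyLe f k := by
  obtain ⟨p, hp⟩ := h
  obtain ⟨q, hq⟩ := h'
  exact ⟨p.comp q, fun a => by simpa using (hp a).trans (eval_mono p (hq a))⟩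

theorem of_le_mul (c : ℕ) (h : ∀ a, f a ≤ c * g a) : PolyLe f g :=
  ⟨.C c * .X, by simpa using h⟩

theorem mono (h : PolyLe f g) (hf : ∀ a, f' a ≤ f a) : PolyLe f' g := (of_le hf).trans h

end PolyLe

/-! ### Polynomial-time programs -/

noncomputable section

variable {O : Type} {orc : O → TM2ComputableAux Γ' Bool}

/-- The number of symbols of a stack of strings. -/
def size (s : List Str) : ℕ := (encode s).length

@[simp] theorem size_nil : size [] = 0 := rfl

@[simp] theorem size_cons (v : Str) (s : List Str) : size (v :: s) = v.length + 1 + size s := by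
  simp [size]; omega

@[simp] theorem size_append (s s' : List Str) : size (s ++ s') = size s + size s' := by
  simp [size, encode]

/-- A piece has finitely many labels, so one constant bounds the pushes of a single step. -/
theorem Piece.Runs.size_le [Finite O] (F : Piece orc) : ∃ C, ∀ (n : ℕ) (d d' : List Str),
    F.Runs n (regs d [] []) (regs d' [] []) → size d' ≤ size d + n * C := by
  obtain ⟨C, hC⟩ := F.exists_pushCount_le
  have hs : ∀ d, ∑ k, (stackOf orc (regs d [] []) k).length = size d := fun d => by
    refine (Finset.sum_eq_single (.reg .data) ?_ (by simp)).trans rfl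
    rintro ((_ | _ | _) | _ | _ | _) <;> simp [stackOf]
  refine ⟨C, fun n d d' ⟨m, hm, h⟩ => ?_⟩
  have := h.sum_length_le hC
  dsimp only at this
  rw [hs, hs] at this
  exact this.trans (Nat.add_le_add_left (Nat.mul_le_mul_right _ hm) _)

variable {α β : Type}

variable (orc) in
/-- A program changes, in polynomial time, the data stack from `r a` to `r' a`, for all `a`. -/
def PolyStep (r r' : α → List Str) : Prop :=
  ∃ (F : Piece orc) (τ : α → ℕ), PolyLe τ (fun a => size (r a)) ∧
    ∀ a t u, F.Runs (τ a) (regs (r a) t u) (regs (r' a) t u)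

variable (orc) in
/-- A program computes, in polynomial time, the string `v a` from the data stack `s a`. -/
def PolyVal (s : α → List Str) (v : α → Str) : Prop := PolyStep orc s (fun a => v a :: s a)

namespace PolyStep

variable {r r' r'' s : α → List Str} {v w : α → Str}

theorem congr {r₁ r₁' : α → List Str} (h : PolyStep orc r r') (hr : ∀ a, r₁ a = r a)
    (hr' : ∀ a, r₁' a = r' a) : PolyStep orc r₁ r₁' := by
  obtain rfl := funext hr
  obtain rfl := funext hr'
  exact h

theorem comap (h : PolyStep orc r r') (g : β → α) :
    PolyStep orc (fun b => r (g b)) (fun b => r' (g b)) := by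
  obtain ⟨F, τ, ⟨p, hp⟩, hF⟩ := h
  exact ⟨F, fun b => τ (g b), ⟨p, fun b => hp (g b)⟩, fun b => hF (g b)⟩

theorem size_le [Finite O] (h : PolyStep orc r r') :
    PolyLe (fun a => size (r' a)) (fun a => size (r a)) := by
  obtain ⟨F, τ, hτ, hF⟩ := h
  obtain ⟨C, hC⟩ := Piece.Runs.size_le F
  exact ((PolyLe.of_le fun a => le_rfl).add (hτ.mul (.const C))).mono fun a => hC _ _ _ (hF a [] [])

/-- The second running time is polynomial in the size of the intermediate stack, which `size_le`
bounds by a polynomial in the size of the initial one. -/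
theorem trans [Finite O] (h : PolyStep orc r r') (h' : PolyStep orc r' r'') :
    PolyStep orc r r'' := by
  have hs := h.size_le
  obtain ⟨F, τ, hτ, hF⟩ := h
  obtain ⟨G, τ', hτ', hG⟩ := h'
  exact ⟨F.seq G, fun a => τ a + τ' a, hτ.add (hτ'.trans hs),
    fun a t u => (hF a t u).seq (hG a t u)⟩

theorem nilTop : PolyStep orc s (fun a => [] :: s a) :=
  ⟨pushEmpty .data, fun _ => 1, .const 1, fun a t u => by
    simpa using pushEmpty_runs (orc := orc) .data (regs (s a) t u)⟩

theorem consTop (c : Γ') : PolyStep orc (fun a => v a :: s a) (fun a => (c :: v a) :: s a) :=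
  ⟨PTLTL.consTop c, fun _ => 1, .const 1, fun _ _ _ => consTop_runs ..⟩

theorem tailTop : PolyStep orc (fun a => v a :: s a) (fun a => (v a).tail :: s a) :=
  ⟨PTLTL.tailTop, fun _ => 1, .const 1, fun _ _ _ => tailTop_runs ..⟩

theorem dropTop : PolyStep orc (fun a => v a :: s a) s :=
  ⟨PTLTL.dropTop .data, fun a => 2 * (v a).length + 1,
    .of_le_mul 2 fun a => by simp; omega, fun a t u => by
    simpa using dropTop_runs (orc := orc) (r := .data) (R := regs (v a :: s a) t u) rfl⟩

/-- Transfer the top string between two registers. -/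
theorem move_runs' (v : Str) (d t u : List Str) :
    (move (orc := orc) .data .aux).Runs (2 * v.length + 2) (regs (v :: d) t u)
      (regs d (v.reverse :: t) u) ∧
    (move (orc := orc) .aux .data).Runs (2 * v.length + 2) (regs d (v :: t) u)
      (regs (v.reverse :: d) t u) ∧
    (move (orc := orc) .data .tmp).Runs (2 * v.length + 2) (regs (v :: d) t u)
      (regs d t (v.reverse :: u)) ∧
    (move (orc := orc) .tmp .data).Runs (2 * v.length + 2) (regs d t (v :: u))
      (regs (v.reverse :: d) t u) ∧
    (move (orc := orc) .tmp .aux).Runs (2 * v.length + 2) (regs d t (v :: u))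
      (regs d (v.reverse :: t) u) := by
  refine ⟨?_, ?_, ?_, ?_, ?_⟩
  · simpa using move_runs (orc := orc) (r := .data) (r' := .aux) (by simp)
      (R := regs (v :: d) t u) rfl
  · simpa using move_runs (orc := orc) (r := .aux) (r' := .data) (by simp)
      (R := regs d (v :: t) u) rfl
  · simpa using move_runs (orc := orc) (r := .data) (r' := .tmp) (by simp)
      (R := regs (v :: d) t u) rfl
  · simpa using move_runs (orc := orc) (r := .tmp) (r' := .data) (by simp)
      (R := regs d t (v :: u)) rfl
  · simpa using move_runs (orc := orc) (r := .tmp) (r' := .aux) (by simp)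
      (R := regs d t (v :: u)) rfl

theorem reverseTop : PolyStep orc (fun a => v a :: s a) (fun a => (v a).reverse :: s a) := by
  refine ⟨(move .data .tmp).seq ((move .tmp .aux).seq (move .aux .data)),
    fun a => 6 * (v a).length + 6, .of_le_mul 6 fun a => by simp; omega, fun a t u => ?_⟩
  refine Piece.Does.mono (((move_runs' _ _ _ _).2.2.1).seq <| ((move_runs' _ _ _ _).2.2.2.2).seq
    (move_runs' _ _ _ _).2.1 |>.congr le_rfl rfl (by simp)) ?_
  simp
  omega

theorem dup : PolyStep orc (fun a => v a :: s a) (fun a => v a :: v a :: s a) := by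
  refine ⟨(move .data .aux).seq ((copy .aux .data .tmp).seq ((move .tmp .aux).seq
    (move .aux .data))), fun a => 8 * (v a).length + 9, .of_le_mul 9 fun a => by simp; omega,
    fun a t u => ?_⟩
  have h := copy_runs (orc := orc) (r := .aux) (r' := .data) (r'' := .tmp) (by simp) (by simp)
    (by simp) (R := regs (s a) ((v a).reverse :: t) u) rfl
  simp only [regs_data, regs_tmp, update_regs_data, update_regs_aux, update_regs_tmp,
    List.reverse_reverse] at h
  have h' := (move_runs' (orc := orc) (v a).reverse (v a :: s a) t u).2.1
  rw [List.reverse_reverse] at h'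
  refine Piece.Does.mono (((move_runs' _ _ _ _).1).seq <| h.seq <|
    ((move_runs' _ _ _ _).2.2.2.2).seq h') ?_
  simp
  omega

theorem swap : PolyStep orc (fun a => v a :: w a :: s a) (fun a => w a :: v a :: s a) := by
  refine ⟨(move .data .aux).seq ((move .data .tmp).seq ((move .aux .data).seq
    (move .tmp .data))), fun a => 4 * (v a).length + 4 * (w a).length + 8,
    .of_le_mul 4 fun a => by simp; omega, fun a t u => ?_⟩
  have h := (move_runs' (orc := orc) (v a).reverse (s a) t ((w a).reverse :: u)).2.1
  have h' := (move_runs' (orc := orc) (w a).reverse (v a :: s a) t u).2.2.2.1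
  rw [List.reverse_reverse] at h h'
  refine Piece.Does.mono (((move_runs' _ _ _ _).1).seq <| ((move_runs' _ _ _ _).2.2.1).seq <|
    h.seq h') ?_
  simp
  omega

/-- The top string is parked on `aux` meanwhile. This is legitimate because a `PolyStep` program
works over arbitrary contents of the auxiliary registers. -/
theorem dip (h : PolyStep orc r r') :
    PolyStep orc (fun a => v a :: r a) (fun a => v a :: r' a) := by
  obtain ⟨F, τ, hτ, hF⟩ := h
  refine ⟨(move .data .aux).seq (F.seq (move .aux .data)), fun a => τ a + 4 * (v a).length + 4,
    ?_, fun a t u => ?_⟩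
  · refine (PolyLe.add (hτ.trans (.of_le fun a => ?_)) (.of_le_mul 4 fun a => ?_)).mono
      fun a => (add_assoc _ _ _).le
    · simp
    · simp; omega
  · have h := (move_runs' (orc := orc) (v a).reverse (r' a) t u).2.1
    rw [List.reverse_reverse] at h
    refine Piece.Does.mono (((move_runs' _ _ _ _).1).seq <| (hF _ _ _).seq h) ?_
    simp
    omega

/-- Indexing the branches by subtypes means that each program has to be correct, and fast, only
where its branch is taken. -/
theorem ite (p : Option Γ' → Bool)
    (h : PolyStep orc (fun a : {a // p (v a).head? = true} => v a :: s a) (fun a => r' a))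
    (h' : PolyStep orc (fun a : {a // p (v a).head? = false} => v a :: s a) (fun a => r' a)) :
    PolyStep orc (fun a => v a :: s a) r' := by
  obtain ⟨F, τ, ⟨f, hf⟩, hF⟩ := h
  obtain ⟨G, τ', ⟨g, hg⟩, hG⟩ := h'
  have hhead : ∀ a, ((v a).head?.map some).getD none = (v a).head? := by
    intro a; cases v a <;> rfl
  refine ⟨.choice (.peek (.reg .data) (fun m c => (c.join, m.2)) <| .branch (fun m => p m.1)
    (.load (fun m => (none, m.2)) <| .goto fun _ => some true)
    (.load (fun m => (none, m.2)) <| .goto fun _ => some false)) F G,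
    fun a => (if h : p (v a).head? = true then τ ⟨a, h⟩ else τ' ⟨a, by simpa using h⟩) + 1,
    ⟨f + g + 1, fun a => ?_⟩, fun a t u => ?_⟩
  · by_cases h : p (v a).head? = true
    · simpa [h] using (hf ⟨a, h⟩).trans (by simp)
    · simpa [h] using (hg ⟨a, by simpa using h⟩).trans (by simp)
  · by_cases h : p (v a).head? = true
    · obtain ⟨m, hm, e⟩ := hF ⟨a, h⟩ t u
      exact ⟨m + 1, by simpa [h] using hm,
        .choice_true (by simp [hhead, h, idle]) e⟩
    · obtain ⟨m, hm, e⟩ := hG ⟨a, by simpa using h⟩ t u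
      exact ⟨m + 1, by simpa [h] using hm,
        .choice_false (by simp [hhead, h, idle]) e⟩

/-- The result of running through the nonempty tails of a list. -/
def foldTails {X : Type} (step : β → X → List X → β) : β → List X → β
  | b, [] => b
  | b, x :: xs => foldTails step (step b x xs) xs

variable (orc) in
/-- Go on if the top string of the data stack is not empty. -/
def testTop : TM2.Stmt (Alph orc) (Option Unit) (Mem orc) :=
  .peek (.reg .data) (fun m c => (c.join, m.2)) <| .branch (fun m => m.1.isSome)
    (.load (fun m => (none, m.2)) <| .goto fun _ => some ())
    (.load (fun m => (none, m.2)) <| .goto fun _ => none)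

/-- Growth of the state by a constant per round keeps the loop polynomial; doubling it in every
round would already be fatal. The body is required for all states and lists, so one program and one
polynomial serve every round. -/
theorem fold {X : Type} {encL : List X → Str} {rep : β → List Str}
    (step : α → β → X → List X → β) (C : ℕ) (h0 : encL [] = [])
    (hlen : ∀ x xs, (encL xs).length + 1 ≤ (encL (x :: xs)).length)
    (hC : ∀ a b x xs, size (rep (step a b x xs)) ≤ size (rep b) + C)
    (body : PolyStep orc
      (fun z : α × β × X × List X => encL (z.2.2.1 :: z.2.2.2) :: rep z.2.1 ++ s z.1)
      (fun z => encL z.2.2.2 :: rep (step z.1 z.2.1 z.2.2.1 z.2.2.2) ++ s z.1))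
    (l : α → List X) (b : α → β) :
    PolyStep orc (fun a => encL (l a) :: rep (b a) ++ s a)
      (fun a => [] :: rep (foldTails (step a) (b a) (l a)) ++ s a) := by
  obtain ⟨F, τ, ⟨p, hp⟩, hF⟩ := body
  have hl : ∀ xs, xs.length ≤ (encL xs).length := by
    intro xs
    induction xs with
    | nil => simp
    | cons x xs ih =>
      have := hlen x xs
      simp only [List.length_cons]
      omega
  refine ⟨.loop (testTop orc) F,
    fun a => (l a).length * (p.eval ((C + 1) * size (encL (l a) :: rep (b a) ++ s a)) + 1) + 1,
    ?_, fun a t u => ?_⟩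
  · refine PolyLe.add (.mul (.of_le fun a => ?_) (.add ?_ (.const 1))) (.const 1)
    · have := hl (l a)
      simp only [List.cons_append, size_cons]
      omega
    · exact PolyLe.trans ⟨p, fun a => le_rfl⟩ (.of_le_mul (C + 1) fun a => le_rfl)
  -- `M` bounds the stack in every round: the list loses at least one symbol, and the growth of the
  -- state by at most `C` is paid for by the term `C * xs.length`. Initially `C + 1` times the stack
  -- size is enough, since a list has no more items than its encoding has symbols.
  · have key : ∀ M xs b, size (encL xs :: rep b ++ s a) + C * xs.length ≤ M →
        Piece.Runs (.loop (testTop orc) F) (xs.length * (p.eval M + 1) + 1)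
        (regs (encL xs :: rep b ++ s a) t u)
        (regs ([] :: rep (foldTails (step a) b xs) ++ s a) t u) := by
      intro M xs
      induction xs with
      | nil =>
        intro b _
        refine ⟨1, by simp, .loop_exit ?_⟩
        simp [h0, idle, foldTails, testTop]
      | cons x xs ih =>
        intro b hM
        obtain ⟨m, hm, e⟩ := hF (a, b, x, xs) t u
        have h1 := hC a b x xs
        have h2 := hlen x xs
        simp only [List.cons_append, size_cons, size_append, List.length_cons, mul_add] at hM
        obtain ⟨n, hn, e'⟩ := ih (step a b x xs) (by
          simp only [List.cons_append, size_cons, size_append]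
          omega)
        refine ⟨m + n + 1, ?_, .loop_next ?_ e e'⟩
        · have h3 := (hm.trans (hp (a, b, x, xs))).trans (eval_mono p (n := M) (by
            simp only [List.cons_append, size_cons, size_append]
            omega))
          simp only [List.length_cons, add_mul]
          omega
        · obtain ⟨c, v, hv⟩ : ∃ c v, encL (x :: xs) = c :: v := by
            cases h : encL (x :: xs) with
            | nil => simp [h] at h2
            | cons c v => exact ⟨c, v, rfl⟩
          simp [hv, idle, testTop]
    refine key _ _ _ ?_
    have := hl (l a)
    simp only [List.cons_append, size_cons, size_append]
    nlinarith

theorem call {X : Type} {code : X → Str} {res : X → List Bool} {o : O} {p : Polynomial ℕ}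
    (h : ∀ x, Nonempty (TM2OutputsInTime (orc o).tm ((code x).map (orc o).inputAlphabet.invFun)
      (some ((res x).map (orc o).outputAlphabet.invFun)) (p.eval (code x).length)))
    (x : α → X) : PolyStep orc (fun a => code (x a) :: s a)
      (fun a => (res (x a)).map .bit :: s a) := by
  have hs : ∀ x, ∃ n ≤ p.eval (code x).length, Steps (orc o).tm.m n
      (initList (orc o).tm ((code x).map (orc o).inputAlphabet.symm))
      (haltList (orc o).tm ((res x).map (orc o).outputAlphabet.symm)) := by
    intro x
    obtain ⟨⟨n, hn⟩, hle⟩ := h x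
    exact ⟨n, hle, steps_iff.2 hn⟩
  choose n hn hs using hs
  obtain ⟨C, hC⟩ : ∃ C, ∀ l, pushCount ((orc o).tm.m l) ≤ C := by
    have := (orc o).tm.ΛFin
    obtain ⟨C, hC⟩ := (Set.finite_range fun l => pushCount ((orc o).tm.m l)).bddAbove
    exact ⟨C, fun l => hC ⟨l, rfl⟩⟩
  -- The length of an answer is not among the hypotheses; it is bounded because the oracle had to
  -- push the answer within its running time.
  have hlen : ∀ x, (res x).length ≤ (code x).length + n x * C := by
    intro x
    have := (orc o).tm.kFin
    have h := (hs x).sum_length_le hC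
    rw [initList_eq, haltList_eq] at h
    have e : ∀ (k : (orc o).tm.K) (l : List ((orc o).tm.Γ k)),
        ∑ j, (Function.update (fun _ => []) k l j).length = l.length := by
      intro k l
      rw [Finset.sum_eq_single k] <;> simp +contextual [Function.update_of_ne]
    rw [e, e] at h
    simpa using h
  refine ⟨PTLTL.call o, fun a => 4 * (code (x a)).length + 4 * (res (x a)).length + n (x a) + 7,
    ?_, fun a t u => call_runs (hs (x a)) _ _ _⟩
  have h1 : PolyLe (fun a => (code (x a)).length) (fun a => size (code (x a) :: s a)) :=
    .of_le fun a => by simp; omega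
  have h2 : PolyLe (fun a => n (x a)) (fun a => size (code (x a) :: s a)) :=
    PolyLe.trans ⟨p, fun a => hn (x a)⟩ h1
  have h3 := (h1.add (h2.mul (.const C))).mono fun a => hlen (x a)
  exact ((((PolyLe.const 4).mul h1).add ((PolyLe.const 4).mul h3)).add h2).add (.const 7)

end PolyStep

end

set_option linter.unusedSectionVars false

noncomputable section

variable {O : Type} {orc : O → TM2ComputableAux Γ' Bool} [Finite O] {α β : Type}
  {s r : α → List Str} {u v w : α → Str}

/-! ### Values computed in polynomial time -/

namespace PolyStep

/-- The alphabet is finite, so the symbols can be tested one after the other by nested uses of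
`ite`. The index type `A` varies because each failed test passes to a subtype. -/
theorem casesHead {r' : α → List Str} (hv : ∀ a, v a ≠ [])
    (h : ∀ c, PolyStep orc (fun a : {a // (v a).head? = some c} => v a :: s a) (fun a => r' a)) :
    PolyStep orc (fun a => v a :: s a) r' := by
  suffices H : ∀ (l : List Γ') (A : Type) (g : A → α), (∀ x, ∃ c ∈ l, (v (g x)).head? = some c) →
      PolyStep orc (fun x => v (g x) :: s (g x)) (fun x => r' (g x)) by
    refine H [.blank, .bit false, .bit true, .bra, .ket, .comma] α id fun a => ?_
    obtain ⟨c, t, hc⟩ := List.exists_cons_of_ne_nil (hv a)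
    refine ⟨c, ?_, by simp [hc]⟩
    rcases c with _ | (_ | _) | _ | _ | _ <;> simp
  intro l
  induction l with
  | nil =>
    intro A g hg
    -- When no candidate symbol is left the case is impossible, and any program will do.
    have : IsEmpty A := ⟨fun x => by simpa using hg x⟩
    exact ⟨.single .halt, fun _ => 0, .const 0, fun a => isEmptyElim a⟩
  | cons c l ih =>
    intro A g hg
    refine PolyStep.ite (v := fun x => v (g x)) (fun o => o == some c)
      ((h c).comap fun x : {x // ((v (g x)).head? == some c) = true} => ⟨g x.1, by simpa using x.2⟩)
      (ih _ (fun x : {x // ((v (g x)).head? == some c) = false} => g x.1) fun x => ?_)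
    obtain ⟨d, hd, e⟩ := hg x
    have hx : (v (g x)).head? ≠ some c := by simpa using x.2
    rcases List.mem_cons.1 hd with rfl | hd
    · exact absurd e hx
    · exact ⟨d, hd, e⟩

theorem foldl {rep : β → List Str} (step : β → Γ' → β) (C : ℕ)
    (hC : ∀ b c, size (rep (step b c)) ≤ size (rep b) + C)
    (body : ∀ c, PolyStep orc (fun z : α × β => rep z.2 ++ s z.1)
      (fun z => rep (step z.2 c) ++ s z.1)) (v : α → Str) (b : α → β) :
    PolyStep orc (fun a => v a :: rep (b a) ++ s a)
      (fun a => rep ((v a).foldl step (b a)) ++ s a) := by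
  have hf : ∀ (l : Str) b, foldTails (fun b c _ => step b c) b l = l.foldl step b := by
    intro l
    induction l with
    | nil => exact fun _ => rfl
    | cons c l ih => exact fun b => ih _
  refine ((PolyStep.fold (orc := orc) (encL := fun l : List Γ' => l) (rep := rep) (s := s)
    (fun _ b c _ => step b c) C rfl (by simp) (fun _ b c _ => hC b c) ?_ v b).trans
    (dropTop (v := fun _ => []))).congr (fun _ => rfl) fun a => by rw [hf]; rfl
  refine casesHead (by simp) fun c => ?_
  refine (PolyStep.trans (tailTop (v := fun z => z.1.2.2.1 :: z.1.2.2.2))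
    (((body c).comap fun z => (z.1.1, z.1.2.1)).dip)).congr (fun z => rfl) fun z => ?_
  obtain ⟨z, hz⟩ := z
  obtain rfl : z.2.2.1 = c := by simpa using hz
  rfl

end PolyStep

namespace PolyVal

theorem comap (h : PolyVal orc s v) (g : β → α) :
    PolyVal orc (fun b => s (g b)) (fun b => v (g b)) := PolyStep.comap h g

theorem congr (h : PolyVal orc s v) (hw : ∀ a, w a = v a) : PolyVal orc s w := by
  obtain rfl := funext hw
  exact h

theorem top : PolyVal orc (fun a => v a :: s a) v := PolyStep.dup

theorem lift (h : PolyVal orc s v) : PolyVal orc (fun a => u a :: s a) v :=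
  (PolyStep.dip h).trans PolyStep.swap

/-- A program that reads `u` on top of `s` also works with a further value in between: swap that
value to the top and run the program beneath it. -/
theorem insert (h : PolyVal orc (fun a => u a :: s a) w) :
    PolyVal orc (fun a => u a :: v a :: s a) w :=
  PolyStep.swap.trans <| (PolyStep.dip h).trans <| PolyStep.swap.trans <|
    PolyStep.dip PolyStep.swap

theorem lifts (h : PolyVal orc s v) (l : List (α → Str)) :
    PolyVal orc (fun a => l.map (· a) ++ s a) v := by
  induction l with
  | nil => exact h
  | cons u l ih => exact ih.lift

theorem of_mem {l : List (α → Str)} (h : v ∈ l) :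
    PolyVal orc (fun a => l.map (· a) ++ s a) v := by
  induction l with
  | nil => simp at h
  | cons u l ih =>
    rcases List.mem_cons.1 h with rfl | h
    · exact top
    · exact (ih h).lift

/-- Push several values. -/
theorem pushList {l : List (α → Str)} (h : ∀ v ∈ l, PolyVal orc s v) :
    PolyStep orc s (fun a => l.map (· a) ++ s a) := by
  induction l with
  | nil => exact PolyStep.trans PolyStep.nilTop (PolyStep.dropTop (v := fun _ => []))
  | cons u l ih =>
    exact (ih fun v hv => h v (List.mem_cons_of_mem _ hv)).trans
      ((h u List.mem_cons_self).lifts l)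

theorem dropUnder (new old : List (α → Str)) :
    PolyStep orc (fun a => new.map (· a) ++ (old.map (· a) ++ s a))
      (fun a => new.map (· a) ++ s a) := by
  induction new with
  | nil =>
    induction old with
    | nil => exact pushList (l := []) (by simp)
    | cons u old ih => exact PolyStep.dropTop.trans ih
  | cons u new ih => exact ih.dip

/-- Replace the values `old` by the values `new`. -/
theorem assign (old : List (α → Str)) {new : List (α → Str)}
    (h : ∀ v ∈ new, PolyVal orc (fun a => old.map (· a) ++ s a) v) :
    PolyStep orc (fun a => old.map (· a) ++ s a) (fun a => new.map (· a) ++ s a) :=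
  (pushList h).trans (dropUnder new old)

theorem bind (h : PolyVal orc s v) (h' : PolyVal orc (fun a => v a :: s a) w) :
    PolyVal orc s w :=
  PolyStep.trans h (assign [v] (new := [w]) (by simpa using h'))

theorem nil : PolyVal orc s (fun _ => []) := PolyStep.nilTop

theorem cons (h : PolyVal orc s v) (c : Γ') : PolyVal orc s (fun a => c :: v a) :=
  PolyStep.trans h (PolyStep.consTop c)

theorem const (l : Str) : PolyVal orc s (fun _ => l) := by
  induction l with
  | nil => exact nil
  | cons c l ih => exact ih.cons c

theorem tail (h : PolyVal orc s v) : PolyVal orc s (fun a => (v a).tail) :=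
  PolyStep.trans h PolyStep.tailTop

theorem reverse (h : PolyVal orc s v) : PolyVal orc s (fun a => (v a).reverse) :=
  PolyStep.trans h PolyStep.reverseTop

theorem ite (h : PolyVal orc s v) (p : Option Γ' → Bool)
    (h1 : PolyVal orc (fun a : {a // p (v a).head? = true} => s a) (fun a => w a))
    (h2 : PolyVal orc (fun a : {a // p (v a).head? = false} => s a) (fun a => w a)) :
    PolyVal orc s w :=
  PolyStep.trans h (PolyStep.ite p (PolyStep.dropTop.trans h1) (PolyStep.dropTop.trans h2))

/-- The strings `old` initialise the state, which may consist of several strings; after the loop the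
stack shows the strings `new`, of which the desired one is kept. -/
theorem foldl {rep : β → List Str} {step : β → Γ' → β} (C : ℕ)
    (hC : ∀ b c, size (rep (step b c)) ≤ size (rep b) + C)
    (body : ∀ c, PolyStep orc (fun z : α × β => rep z.2 ++ s z.1)
      (fun z => rep (step z.2 c) ++ s z.1)) (hv : PolyVal orc s v) {b : α → β}
    (old : List (α → Str)) (hold : ∀ u ∈ old, PolyVal orc s u)
    (hb : ∀ a, rep (b a) = old.map (· a)) {new : List (α → Str)}
    (hnew : ∀ a, rep ((v a).foldl step (b a)) = new.map (· a)) (hw : w ∈ new) :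
    PolyVal orc s w := by
  have h1 : PolyStep orc s (fun a => v a :: rep (b a) ++ s a) :=
    ((pushList hold).trans (hv.lifts old)).congr (fun _ => rfl) fun a => by simp [hb]
  have h2 := (h1.trans (PolyStep.foldl step C hC body v b)).congr (r₁' := fun a =>
    new.map (· a) ++ s a) (fun _ => rfl) fun a => by rw [hnew]
  exact h2.trans (assign new (new := [w]) (by simpa using of_mem hw))

theorem append (h : PolyVal orc s v) (h' : PolyVal orc s w) :
    PolyVal orc s (fun a => v a ++ w a) := by
  refine foldl (rep := fun b : Str => [b]) (step := fun b c => c :: b) (b := w) 1 ?_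
    (fun c => PolyStep.consTop c) h.reverse [w] (by simpa using h') (fun _ => rfl)
    (new := [fun a => v a ++ w a]) (fun a => ?_) List.mem_cons_self
  · intro b c
    simp +arith
  · simp

end PolyVal

variable (orc) in
/-- A program computes, in polynomial time, the truth value `b a` from the data stack `s a`. -/
def PolyBool (s : α → List Str) (b : α → Bool) : Prop := PolyVal orc s (fun a => [.bit (b a)])

namespace PolyBool

variable {b b' : α → Bool}

theorem const (c : Bool) : PolyBool orc s (fun _ => c) := PolyVal.const _

theorem ite (h : PolyBool orc s b)
    (h1 : PolyVal orc (fun a : {a // b a = true} => s a) (fun a => w a))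
    (h2 : PolyVal orc (fun a : {a // b a = false} => s a) (fun a => w a)) :
    PolyVal orc s w :=
  PolyVal.ite h (fun o => o == some (.bit true))
    (h1.comap fun a : {a // ([Γ'.bit (b a)].head? == some (.bit true)) = true} =>
      ⟨a.1, by simpa using a.2⟩)
    (h2.comap fun a : {a // ([Γ'.bit (b a)].head? == some (.bit true)) = false} =>
      ⟨a.1, by simpa using a.2⟩)

theorem cond (h : PolyBool orc s b) (hv : PolyVal orc s v) (hw : PolyVal orc s w) :
    PolyVal orc s (fun a => bif b a then v a else w a) :=
  h.ite ((hv.comap Subtype.val).congr fun a => by simp [a.2])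
    ((hw.comap Subtype.val).congr fun a => by simp [a.2])

theorem not (h : PolyBool orc s b) : PolyBool orc s (fun a => !b a) :=
  (h.cond (const false) (const true)).congr fun a => by cases h : b a <;> simp [h]

theorem and (h : PolyBool orc s b) (h' : PolyBool orc s b') :
    PolyBool orc s (fun a => b a && b' a) :=
  (h.cond h' (const false)).congr fun a => by cases h : b a <;> simp [h]

theorem head (h : PolyVal orc s v) (p : Option Γ' → Bool) :
    PolyBool orc s (fun a => p (v a).head?) :=
  h.ite p ((const true).congr fun a => by simp [a.2]) ((const false).congr fun a => by simp [a.2])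

theorem isEmpty (h : PolyVal orc s v) : PolyBool orc s (fun a => (v a).isEmpty) :=
  (head h Option.isNone).congr fun a => by cases h : v a <;> simp [h]

end PolyBool

/-! ### String functions -/

/-- The part of a string before the first `c`. -/
def takeUntil (c : Γ') (v : Str) : Str := v.takeWhile (· != c)

/-- The part of a string after the first `c`. -/
def dropThrough (c : Γ') (v : Str) : Str := (v.dropWhile (· != c)).tail

theorem takeUntil_append {c : Γ'} {v : Str} (h : c ∉ v) (w : Str) :
    takeUntil c (v ++ c :: w) = v := by
  induction v with
  | nil => simp [takeUntil]
  | cons d v ih =>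
    simp only [List.mem_cons, not_or] at h
    have := ih h.2
    simp_all [takeUntil, Ne.symm h.1]

theorem dropThrough_append {c : Γ'} {v : Str} (h : c ∉ v) (w : Str) :
    dropThrough c (v ++ c :: w) = w := by
  induction v with
  | nil => simp [dropThrough]
  | cons d v ih =>
    simp only [List.mem_cons, not_or] at h
    have := ih h.2
    simp_all [dropThrough, Ne.symm h.1]

/-- Scan from the right and discard everything collected whenever `c` appears. What survives is the
part to the left of the first `c`, already in the right order. -/
theorem PolyVal.takeUntil (h : PolyVal orc s v) (c : Γ') :
    PolyVal orc s (fun a => takeUntil c (v a)) := by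
  refine PolyVal.foldl (rep := fun b : Str => [b])
    (step := fun b x => if x = c then [] else x :: b) (b := fun _ => []) 1 ?_ (fun x => ?_)
    h.reverse [fun _ => []] (by simpa using PolyVal.nil) (fun _ => rfl)
    (new := [fun a => PTLTL.takeUntil c (v a)]) (fun a => ?_) List.mem_cons_self
  · intro b x
    split_ifs <;> simp +arith
  · by_cases hx : x = c
    · simp only [hx, if_true]
      exact PolyVal.assign [fun z : α × Str => z.2] (new := [fun _ => []]) (by simpa using PolyVal.nil)
    · simp only [hx, if_false]
      exact PolyStep.consTop x
  · simp only [List.foldl_reverse, List.map_cons, List.map_nil]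
    congr 1
    induction v a with
    | nil => rfl
    | cons d l ih =>
      simp only [List.foldr_cons, ih, PTLTL.takeUntil, List.takeWhile_cons]
      by_cases hd : d = c <;> simp [hd]

/-- Collect, in reverse, the symbols from the first `c` on. -/
def collectStep (c : Γ') (b : Str) (x : Γ') : Str :=
  if b.isEmpty then if x = c then [c] else [] else x :: b

/-- Keeping `c` itself in the collection makes nonemptiness the sign that `c` has been seen; the
final `tail` removes it again. -/
theorem foldl_collectStep (c : Γ') (v : Str) :
    (v.foldl (collectStep c) []).reverse.tail = dropThrough c v := by
  have h : ∀ (v b : Str), b ≠ [] → v.foldl (collectStep c) b = v.reverse ++ b := by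
    intro v
    induction v with
    | nil => simp
    | cons d v ih =>
      intro b hb
      rw [List.foldl_cons, ih] <;> simp [collectStep, hb]
  induction v with
  | nil => rfl
  | cons d v ih =>
    by_cases hd : d = c
    · simp [collectStep, hd, dropThrough, h]
    · simpa [collectStep, hd, dropThrough] using ih

theorem PolyVal.dropThrough (h : PolyVal orc s v) (c : Γ') :
    PolyVal orc s (fun a => dropThrough c (v a)) := by
  have : PolyVal orc s (fun a => (v a).foldl (collectStep c) []) := by
    refine PolyVal.foldl (rep := fun b : Str => [b]) (step := collectStep c) (b := fun _ => []) 1 ?_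
      (fun x => ?_) h [fun _ => []] (by simpa using PolyVal.nil) (fun _ => rfl)
      (new := [fun a => (v a).foldl (collectStep c) []]) (fun a => rfl) List.mem_cons_self
    · intro b x
      unfold collectStep
      split_ifs <;> simp +arith
    · refine PolyVal.assign [fun z : α × Str => z.2] (new := [fun z => collectStep c z.2 x]) ?_
      have h1 := PolyVal.top (orc := orc) (v := fun z : α × Str => z.2) (s := fun z => s z.1)
      have := (PolyBool.isEmpty h1).cond (PolyVal.const (if x = c then [c] else [])) (h1.cons x)
      simp only [List.mem_singleton, forall_eq]
      exact this.congr fun z => by simp [collectStep, Bool.cond_eq_ite]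
  exact this.reverse.tail.congr fun a => (foldl_collectStep c (v a)).symm

/-- Compare a string with the string `b`, symbol by symbol. -/
def matchStep (b : Str) (c : Γ') : Str := if b.head? = some c then b.tail else [.blank]

/-- A mismatch replaces the remaining string by a lone blank. As `v` contains no blank, this value
is never matched and persists as a failure mark. -/
theorem foldl_matchStep {v w : Str} (h : Γ'.blank ∉ v) : v.foldl matchStep w = [] ↔ v = w := by
  induction v generalizing w with
  | nil => simp [eq_comm]
  | cons c v ih =>
    simp only [List.mem_cons, not_or] at h
    rw [List.foldl_cons, ih h.2, matchStep]
    cases w with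
    | nil =>
      simp only [List.head?_nil, reduceCtorEq, if_false, iff_false]
      rintro rfl
      simp at h
    | cons d w =>
      by_cases hd : d = c
      · simp [hd]
      · have : v ≠ [.blank] := by
          rintro rfl
          simp at h
        simp [hd, this, Ne.symm hd]

theorem PolyBool.eq (hv : PolyVal orc s v) (hw : PolyVal orc s w) (h : ∀ a, Γ'.blank ∉ v a) :
    PolyBool orc s (fun a => v a == w a) := by
  have : PolyVal orc s (fun a => (v a).foldl matchStep (w a)) := by
    refine PolyVal.foldl (rep := fun b : Str => [b]) (step := matchStep) (b := w) 1 ?_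
      (fun c => ?_) hv [w] (by simpa using hw) (fun _ => rfl)
      (new := [fun a => (v a).foldl matchStep (w a)]) (fun a => rfl) List.mem_cons_self
    · intro b c
      unfold matchStep
      split_ifs <;> simp +arith
    · refine PolyVal.assign [fun z : α × Str => z.2] (new := [fun z => matchStep z.2 c]) ?_
      have h1 := PolyBool.head (PolyVal.top (orc := orc) (v := fun z : α × Str => z.2)
        (s := fun z => s z.1)) (fun o => o == some c)
      have := (h1.cond PolyVal.top.tail (PolyVal.const [.blank]))
      simp only [List.mem_singleton, forall_eq]
      refine this.congr fun z => ?_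
      by_cases hz : z.2.head? = some c <;> simp [matchStep, hz, Bool.cond_eq_ite]
  refine (PolyBool.isEmpty this).congr fun a => ?_
  congr 2
  rw [Bool.eq_iff_iff]
  simp [foldl_matchStep (h a)]

/-- Run through the items of an encoded list, with a state of bounded size. -/
theorem PolyVal.foldTails {X : Type} {encL : List X → Str} {code : β → Str}
    (hcode : ∀ b, (code b).length ≤ 1) (step : α → β → X → List X → β) (h0 : encL [] = [])
    (hlen : ∀ x xs, (encL xs).length + 1 ≤ (encL (x :: xs)).length)
    (htail : PolyVal orc (fun z : α × β × X × List X =>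
      encL (z.2.2.1 :: z.2.2.2) :: code z.2.1 :: s z.1) (fun z => encL z.2.2.2))
    (hstep : PolyVal orc (fun z : α × β × X × List X =>
      encL (z.2.2.1 :: z.2.2.2) :: code z.2.1 :: s z.1)
      (fun z => code (step z.1 z.2.1 z.2.2.1 z.2.2.2)))
    {l : α → List X} (hl : PolyVal orc s (fun a => encL (l a))) {b : α → β}
    (hb : PolyVal orc s (fun a => code (b a))) :
    PolyVal orc s (fun a => code (PolyStep.foldTails (step a) (b a) (l a))) := by
  -- The state is one string of at most one symbol, which occupies at most 2 places with its end
  -- marker; hence the constant.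
  have h1 := PolyStep.fold (orc := orc) (s := s) (rep := fun b => [code b]) step 2 h0 hlen
    (fun a b x xs => by
      have := hcode (step a b x xs)
      simp; omega)
    (PolyVal.assign [fun z : α × β × X × List X => encL (z.2.2.1 :: z.2.2.2), fun z => code z.2.1]
      (new := [fun z => encL z.2.2.2, fun z => code (step z.1 z.2.1 z.2.2.1 z.2.2.2)])
      (by simpa using ⟨htail, hstep⟩)) l b
  exact (PolyStep.trans hb hl.lift).trans (h1.trans PolyStep.dropTop)

end

noncomputable section

/-! ### Strings for histories -/

variable {L : Signature}

/-- A binary string. -/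
def bits (l : List Bool) : Str := l.map .bit

theorem bits_injective : Function.Injective bits :=
  List.map_injective_iff.2 fun a b h => by cases h; rfl

theorem notMem_bits {c : Γ'} (hc : ∀ b, c ≠ .bit b) (l : List Bool) : c ∉ bits l := by
  simp [bits, eq_comm, hc]

theorem codeTuple_zero {Δ : Fin 0 → L.BaseType} (c : (i : Fin 0) → L.Dom (Δ i)) :
    codeTuple c = [] := by
  simp [codeTuple]

theorem codeTuple_succ {n : ℕ} {Δ : Fin (n + 1) → L.BaseType}
    (c : (i : Fin (n + 1)) → L.Dom (Δ i)) :
    codeTuple c = bits (L.code (c 0)) ++ .comma :: codeTuple (fun i => c i.succ) := by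
  simp [codeTuple, List.ofFn_succ, bits]

theorem notMem_codeTuple {x : Γ'} (hx : ∀ b, x ≠ .bit b) (hx' : x ≠ .comma) {n : ℕ}
    {Δ : Fin n → L.BaseType} (c : (i : Fin n) → L.Dom (Δ i)) : x ∉ codeTuple c := by
  induction n with
  | zero => simp [codeTuple_zero]
  | succ n ih => simp [codeTuple_succ, ih, notMem_bits hx, hx']

theorem takeUntil_codeTuple {n : ℕ} {Δ : Fin n → L.BaseType} (c : (i : Fin n) → L.Dom (Δ i))
    (k : Fin n) :
    takeUntil .comma ((dropThrough .comma)^[k] (codeTuple c)) = bits (L.code (c k)) := by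
  have h : ∀ l, Γ'.comma ∉ bits l := notMem_bits (by simp)
  induction n with
  | zero => exact k.elim0
  | succ n ih =>
    rw [codeTuple_succ]
    cases k using Fin.cases with
    | zero => exact takeUntil_append (h _) _
    | succ k =>
      rw [Fin.val_succ, Function.iterate_succ_apply, dropThrough_append (h _), ih]

theorem codeTuple_injective {n : ℕ} {Δ : Fin n → L.BaseType} :
    Function.Injective (codeTuple : ((i : Fin n) → L.Dom (Δ i)) → _) := by
  intro c c' h
  funext k
  apply L.code_injective
  apply bits_injective
  rw [← takeUntil_codeTuple, ← takeUntil_codeTuple, h]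

/-- An event as a string without brackets. -/
def evStr (e : Event L) : Str := bits (L.predName e.1) ++ .comma :: codeTuple e.2

theorem takeUntil_evStr (e : Event L) : takeUntil .comma (evStr e) = bits (L.predName e.1) :=
  takeUntil_append (notMem_bits (by simp) _) _

theorem dropThrough_evStr (e : Event L) : dropThrough .comma (evStr e) = codeTuple e.2 :=
  dropThrough_append (notMem_bits (by simp) _) _

/-- Names and codes consist of bits only, so the commas split the string uniquely; the name fixes
the predicate symbol and hence the types in which codes are injective. -/
theorem evStr_injective : Function.Injective (evStr : Event L → Str) := by
  rintro ⟨p, c⟩ ⟨p', c'⟩ h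
  obtain rfl : p = p' := L.predName_injective <| bits_injective <| by
    rw [← takeUntil_evStr ⟨p, c⟩, ← takeUntil_evStr ⟨p', c'⟩, h]
  obtain rfl : c = c' := codeTuple_injective <| by
    rw [← dropThrough_evStr ⟨p, c⟩, ← dropThrough_evStr ⟨p, c'⟩, h]
  rfl

theorem notMem_evStr {x : Γ'} (hx : ∀ b, x ≠ .bit b) (hx' : x ≠ .comma) (e : Event L) :
    x ∉ evStr e := by
  simp [evStr, notMem_bits hx, hx', notMem_codeTuple hx hx']

/-- A session as a string: each event is followed by a closing bracket. -/
def sessionStr (l : List (Event L)) : Str := l.flatMap fun e => evStr e ++ [.ket]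

/-- A list of sessions as a string: each session is followed by a blank. -/
def historyStr (W : List (List (Event L))) : Str := W.flatMap fun l => sessionStr l ++ [.blank]

theorem sessionStr_cons (e : Event L) (l : List (Event L)) :
    sessionStr (e :: l) = evStr e ++ .ket :: sessionStr l := by simp [sessionStr]

theorem historyStr_cons (l : List (Event L)) (W : List (List (Event L))) :
    historyStr (l :: W) = sessionStr l ++ .blank :: historyStr W := by simp [historyStr]

theorem historyStr_isEmpty (W : List (List (Event L))) :
    (historyStr W).isEmpty = W.isEmpty := by
  cases W <;> simp [historyStr]

theorem blank_notMem_sessionStr (l : List (Event L)) : Γ'.blank ∉ sessionStr l := by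
  simp [sessionStr, notMem_evStr]

theorem takeUntil_sessionStr (e : Event L) (l : List (Event L)) :
    takeUntil .ket (sessionStr (e :: l)) = evStr e := by
  rw [sessionStr_cons]
  exact takeUntil_append (notMem_evStr (by simp) (by simp) e) _

theorem dropThrough_sessionStr (e : Event L) (l : List (Event L)) :
    dropThrough .ket (sessionStr (e :: l)) = sessionStr l := by
  rw [sessionStr_cons]
  exact dropThrough_append (notMem_evStr (by simp) (by simp) e) _

theorem takeUntil_historyStr (l : List (Event L)) (W : List (List (Event L))) :
    takeUntil .blank (historyStr (l :: W)) = sessionStr l := by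
  rw [historyStr_cons]
  exact takeUntil_append (blank_notMem_sessionStr l) _

theorem dropThrough_historyStr (l : List (Event L)) (W : List (List (Event L))) :
    dropThrough .blank (historyStr (l :: W)) = historyStr W := by
  rw [historyStr_cons]
  exact dropThrough_append (blank_notMem_sessionStr l) _

/-! ### The forcing relation at the newest session -/

/-- All operators look backwards, so sessions after `i` are irrelevant. -/
theorem holds_congr {h h' : History L} {V : Type} {Γ : V → L.BaseType} (ψ : Formula L Γ)
    (ρ : (x : V) → L.Dom (Γ x)) {i : ℕ} (hi : 1 ≤ i)
    (hs : ∀ j, 1 ≤ j → j ≤ i → h.session j = h'.session j) :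
    Holds h ψ ρ i ↔ Holds h' ψ ρ i := by
  induction ψ generalizing i with
  | atom p t => simp only [Holds, hs i hi le_rfl]
  | rel R t => rfl
  | and ψ₁ ψ₂ ih₁ ih₂ => simp only [Holds, ih₁ ρ hi hs, ih₂ ρ hi hs]
  | neg ψ ih => simp only [Holds, ih ρ hi hs]
  | prev ψ ih =>
    simp only [Holds]
    exact and_congr_right fun h1 => ih ρ (by omega) fun j hj hj' => hs j hj (by omega)
  | since ψ₁ ψ₂ ih₁ ih₂ =>
    simp only [Holds]
    refine exists_congr fun j => and_congr_right fun h1 => and_congr_right fun h2 => and_congr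
      (ih₂ ρ h1 fun k hk hk' => hs k hk (by omega)) (forall_congr' fun k => forall_congr' fun h3 =>
      forall_congr' fun h4 => ih₁ ρ (by omega) fun m hm hm' => hs m hm (by omega))
  | all p hp ψ ih =>
    simp only [Holds, hs i hi le_rfl]
    exact forall_congr' fun c => forall_congr' fun _ => ih _ hi hs

open Classical in
/-- `ψ` holds at the newest session of a history, whose sessions are listed from the newest to
the oldest. -/
def HoldsAt (W : List (List (Event L))) {V : Type} {Γ : V → L.BaseType} (ψ : Formula L Γ)
    (ρ : (x : V) → L.Dom (Γ x)) : Prop :=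
  Holds (W.reverse.map List.toFinset) ψ ρ W.length

section HoldsAt

variable {V : Type} {Γ : V → L.BaseType} (l : List (Event L)) (W : List (List (Event L)))
  (ρ : (x : V) → L.Dom (Γ x))

open Classical in
theorem holds_cons_iff (ψ : Formula L Γ) {i : ℕ} (hi : 1 ≤ i) (hi' : i ≤ W.length) :
    Holds ((l :: W).reverse.map List.toFinset) ψ ρ i ↔
      Holds (W.reverse.map List.toFinset) ψ ρ i := by
  refine holds_congr ψ ρ hi fun j hj hj' => ?_
  simp only [History.session, List.getD_eq_getElem?_getD, List.reverse_cons, List.map_append]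
  rw [List.getElem?_append_left (by simp; omega)]

open Classical in
theorem session_length :
    History.session ((l :: W).reverse.map List.toFinset) (l :: W).length = l.toFinset := by
  simp [History.session, List.getD_eq_getElem?_getD]

theorem holdsAt_atom (p : L.Pred) (t : (i : Fin (L.predArity p)) → Term L Γ (L.predType p i)) :
    HoldsAt (l :: W) (.atom p t) ρ ↔ (⟨p, fun k => (t k).eval ρ⟩ : Event L) ∈ l := by
  simp only [HoldsAt, Holds, session_length, List.mem_toFinset]

theorem holdsAt_all (p : L.Pred) (hp : 1 ≤ L.predArity p)
    (ψ : Formula L (V := Fin (L.predArity p) ⊕ V) (Sum.elim (L.predType p) Γ)) :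
    HoldsAt (l :: W) (.all p hp ψ) ρ ↔
      ∀ e ∈ l, ∀ c, e = ⟨p, c⟩ → HoldsAt (l :: W) ψ (extend c ρ) := by
  simp only [HoldsAt, Holds, session_length, List.mem_toFinset]
  exact ⟨fun h e he c hc => h c (hc ▸ he), fun h c hc => h _ hc c rfl⟩

theorem holdsAt_prev (ψ : Formula L Γ) :
    HoldsAt (l :: W) (.prev ψ) ρ ↔ W ≠ [] ∧ HoldsAt W ψ ρ := by
  simp only [HoldsAt, Holds, List.length_cons, Nat.add_sub_cancel]
  rcases W.eq_nil_or_concat with rfl | ⟨W', l', rfl⟩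
  · simp
  · refine and_congr (by simp) (holds_cons_iff _ _ _ _ (by simp) le_rfl)

theorem holdsAt_since_nil (ψ₁ ψ₂ : Formula L Γ) : ¬ HoldsAt [] (.since ψ₁ ψ₂) ρ := by
  simp only [HoldsAt, Holds, List.length_nil]
  omega

/-- The witness `j` is either the newest instant or an older one. In the second case `ψ₁` holds now,
and `j` is a witness for the history without its newest session. -/
theorem holdsAt_since (ψ₁ ψ₂ : Formula L Γ) :
    HoldsAt (l :: W) (.since ψ₁ ψ₂) ρ ↔ HoldsAt (l :: W) ψ₂ ρ ∨
      HoldsAt (l :: W) ψ₁ ρ ∧ HoldsAt W (.since ψ₁ ψ₂) ρ := by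
  simp only [HoldsAt, Holds]
  constructor
  · rintro ⟨j, h1, h2, h3, h4⟩
    rcases h2.eq_or_lt with rfl | h2
    · exact .inl h3
    · have h2' : j ≤ W.length := by simp only [List.length_cons] at h2; omega
      exact .inr ⟨h4 _ h2 le_rfl, j, h1, h2', (holds_cons_iff l W ρ ψ₂ h1 h2').1 h3,
        fun k hk hk' => (holds_cons_iff l W ρ ψ₁ (by omega) hk').1
          (h4 k hk (by simp only [List.length_cons]; omega))⟩
  · rintro (h | ⟨h, j, h1, h2, h3, h4⟩)
    · exact ⟨_, by simp, le_rfl, h, fun k hk hk' => by omega⟩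
    · refine ⟨j, h1, by simp only [List.length_cons]; omega, (holds_cons_iff l W ρ ψ₂ h1 h2).2 h3,
        fun k hk hk' => ?_⟩
      rcases hk'.eq_or_lt with rfl | hk'
      · exact h
      · have hk'' : k ≤ W.length := by simp only [List.length_cons] at hk'; omega
        exact (holds_cons_iff l W ρ ψ₁ (by omega) hk'').2 (h4 k hk hk'')

end HoldsAt

/-! ### Evaluation in polynomial time -/

/-- The machine `M` computes `res` in polynomial time, where the arguments are written with
`code`. -/
def Answers (M : TM2ComputableAux Γ' Bool) {X : Type} (code : X → Str) (res : X → List Bool) :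
    Prop :=
  ∃ p : Polynomial ℕ, ∀ x, Nonempty (TM2OutputsInTime M.tm
    ((code x).map M.inputAlphabet.invFun) (some ((res x).map M.outputAlphabet.invFun))
    (p.eval (code x).length))

variable {O : Type} {orc : O → TM2ComputableAux Γ' Bool} [Finite O] {α : Type}
  {s : α → List Str}

theorem PolyVal.call {X : Type} {code : X → Str} {res : X → List Bool} {o : O}
    (h : Answers (orc o) code res) {x : α → X} (hx : PolyVal orc s (fun a => code (x a))) :
    PolyVal orc s (fun a => bits (res (x a))) := by
  obtain ⟨p, hp⟩ := h
  exact PolyStep.trans hx (PolyStep.call hp x)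

theorem PolyVal.codeTuple {n : ℕ} {Δ : Fin n → L.BaseType} {c : α → (i : Fin n) → L.Dom (Δ i)}
    (h : ∀ i, PolyVal orc s (fun a => bits (L.code (c a i)))) :
    PolyVal orc s (fun a => codeTuple (c a)) := by
  induction n with
  | zero => exact PolyVal.nil.congr fun a => codeTuple_zero _
  | succ n ih =>
    exact ((h 0).append ((ih fun i => h i.succ).cons .comma)).congr fun a => codeTuple_succ _

theorem PolyVal.term {V : Type} {Γ : V → L.BaseType} {ρ : α → (x : V) → L.Dom (Γ x)}
    (hρ : ∀ x, PolyVal orc s (fun a => bits (L.code (ρ a x)))) {τ : L.BaseType}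
    (t : Term L Γ τ) (hf : ∀ f, t.HasFn f →
      ∃ o, Answers (orc o) PTLTL.codeTuple (fun c => L.code (L.fnInterp f c))) :
    PolyVal orc s (fun a => bits (L.code (t.eval (ρ a)))) := by
  induction t with
  | var x => exact hρ x
  | const c => exact (PolyVal.const (bits (L.code c))).congr fun _ => rfl
  | app f t ih =>
    obtain ⟨o, ho⟩ := hf f (.inl rfl)
    exact PolyVal.call (x := fun a i => (t i).eval (ρ a)) ho
      (PolyVal.codeTuple fun i => ih i fun g hg => hf g (.inr ⟨i, hg⟩))

theorem sessionStr_length_lt (e : Event L) (l : List (Event L)) :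
    (sessionStr l).length + 1 ≤ (sessionStr (e :: l)).length := by
  simp [sessionStr_cons]

theorem historyStr_length_lt (l : List (Event L)) (W : List (List (Event L))) :
    (historyStr W).length + 1 ≤ (historyStr (l :: W)).length := by
  simp [historyStr_cons]

theorem foldTails_and {X : Type} (q : X → Bool) (b : Bool) (l : List X) :
    PolyStep.foldTails (fun b x _ => b && q x) b l = (b && l.all q) := by
  induction l generalizing b with
  | nil => simp [PolyStep.foldTails]
  | cons x l ih => simp [PolyStep.foldTails, ih, Bool.and_assoc]

/-- Check all events of a session. -/
theorem PolyBool.all {l : α → List (Event L)} (hl : PolyVal orc s (fun a => sessionStr (l a)))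
    {q : α → Event L → Bool}
    (hq : PolyBool orc (fun z : α × Event L => evStr z.2 :: s z.1) (fun z => q z.1 z.2)) :
    PolyBool orc s (fun a => (l a).all (q a)) := by
  have hstep : PolyBool orc (fun z : α × Bool × Event L × List (Event L) =>
      sessionStr (z.2.2.1 :: z.2.2.2) :: [.bit z.2.1] :: s z.1)
      (fun z => z.2.1 && q z.1 z.2.2.1) := by
    refine PolyBool.and (PolyVal.lift PolyVal.top) ?_
    refine PolyVal.bind (v := fun z => evStr z.2.2.1)
      ((PolyVal.top.takeUntil .ket).congr fun z => (takeUntil_sessionStr _ _).symm) ?_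
    exact (hq.comap fun z : α × Bool × Event L × List (Event L) => (z.1, z.2.2.1)).insert.insert
  have h := PolyVal.foldTails (orc := orc) (s := s) (encL := sessionStr)
    (code := fun b => [.bit b]) (by simp) (fun a b x _ => b && q a x) rfl sessionStr_length_lt
    ((PolyVal.top.dropThrough .ket).congr fun z => (dropThrough_sessionStr _ _).symm) hstep
    hl (b := fun _ => true) (PolyBool.const true)
  exact h.congr fun a => by rw [foldTails_and]; simp

/-- The step from a session to the next older one in the evaluation of `ψ₁ S ψ₂`, where `b₁` and
`b₂` are the truth values of `ψ₁` and `ψ₂`. -/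
def sinceStep (b₁ b₂ : Bool) : Option Bool → Option Bool
  | some b => some b
  | none => bif b₂ then some true else bif b₁ then none else some false

/-- The arguments of an event, given its predicate symbol. -/
def argsOf {p : L.Pred} : {e : Event L} → e.1 = p → (k : Fin (L.predArity p)) →
    L.Dom (L.predType p k)
  | ⟨_, c⟩, rfl => c

theorem eq_mk_iff {p : L.Pred} {e : Event L} (h : e.1 = p)
    (c : (k : Fin (L.predArity p)) → L.Dom (L.predType p k)) : e = ⟨p, c⟩ ↔ argsOf h = c := by
  obtain ⟨q, d⟩ := e
  cases h
  exact ⟨fun h => by cases h; rfl, fun h => by cases h; rfl⟩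

theorem codeTuple_argsOf {p : L.Pred} {e : Event L} (h : e.1 = p) :
    codeTuple (argsOf h) = dropThrough .comma (evStr e) := by
  rw [dropThrough_evStr]
  obtain ⟨q, d⟩ := e
  cases h
  rfl

theorem PolyVal.dropThrough_iterate {v : α → Str} (h : PolyVal orc s v) (c : Γ') (k : ℕ) :
    PolyVal orc s (fun a => (PTLTL.dropThrough c)^[k] (v a)) := by
  induction k with
  | zero => exact h
  | succ k ih => exact (ih.dropThrough c).congr fun a => Function.iterate_succ_apply' ..

-- The state `none` means that `ψ₁` has held without interruption and no witness for `ψ₂` has been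
-- met; a state `some b` is final. If the history is exhausted in state `none` there is no witness,
-- so only `some true` counts as success.
open Classical in
theorem foldTails_since {V : Type} {Γ : V → L.BaseType} (ψ₁ ψ₂ : Formula L Γ)
    (ρ : (x : V) → L.Dom (Γ x)) (W : List (List (Event L))) :
    PolyStep.foldTails (fun b l W => sinceStep (decide (HoldsAt (l :: W) ψ₁ ρ))
      (decide (HoldsAt (l :: W) ψ₂ ρ)) b) none W = some true ↔ HoldsAt W (.since ψ₁ ψ₂) ρ := by
  have hs : ∀ (W : List (List (Event L))) b, PolyStep.foldTails (fun b l W =>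
      sinceStep (decide (HoldsAt (l :: W) ψ₁ ρ)) (decide (HoldsAt (l :: W) ψ₂ ρ)) b) (some b) W =
      some b := by
    intro W b
    induction W with
    | nil => rfl
    | cons l W ih => exact ih
  induction W with
  | nil => simp [PolyStep.foldTails, holdsAt_since_nil]
  | cons l W ih =>
    rw [PolyStep.foldTails, holdsAt_since]
    by_cases h2 : HoldsAt (l :: W) ψ₂ ρ
    · simpa [sinceStep, h2] using hs W true
    · by_cases h1 : HoldsAt (l :: W) ψ₁ ρ
      · simpa [sinceStep, h1, h2] using ih
      · simp only [h1, h2, decide_false, sinceStep, cond_false, false_and, or_self, iff_false]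
        exact fun h => by simpa using (hs W false).symm.trans h

-- Induction on the formula, over arbitrary index types, stacks and assignments. An assignment is
-- not stored as such: for each variable there is a program that computes its value from the current
-- stack. This allows `since` and `all` to place loop data on the stack, as `lift` carries the older
-- programs along.
open Classical in
theorem PolyBool.holdsAt {V : Type} {Γ : V → L.BaseType} (ψ : Formula L Γ)
    (hF : ∀ f, ψ.HasFn f →
      ∃ o, Answers (orc o) PTLTL.codeTuple (fun c => L.code (L.fnInterp f c)))
    (hR : ∀ R, ψ.HasRel R →
      ∃ o, Answers (orc o) PTLTL.codeTuple (fun c => [decide (L.relInterp R c)]))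
    {α : Type} {s : α → List Str} {W : α → List (List (Event L))} (hW : ∀ a, W a ≠ [])
    {ρ : α → (x : V) → L.Dom (Γ x)} (hs : PolyVal orc s (fun a => historyStr (W a)))
    (hρ : ∀ x, PolyVal orc s (fun a => bits (L.code (ρ a x)))) :
    PolyBool orc s (fun a => decide (HoldsAt (W a) ψ (ρ a))) := by
  have hsession : ∀ {α : Type} {s : α → List Str} {W : α → List (List (Event L))},
      (∀ a, W a ≠ []) → PolyVal orc s (fun a => historyStr (W a)) →
      PolyVal orc s (fun a => sessionStr ((W a).headD [])) := by
    intro α s W hW h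
    refine (h.takeUntil .blank).congr fun a => ?_
    obtain ⟨l, W', e⟩ := List.exists_cons_of_ne_nil (hW a)
    rw [e, takeUntil_historyStr]
    rfl
  induction ψ generalizing α with
  | atom p t =>
    have he : PolyVal orc s (fun a => evStr (⟨p, fun k => (t k).eval (ρ a)⟩ : Event L)) :=
      (PolyVal.const (bits (L.predName p))).append ((PolyVal.codeTuple
        fun i => .term hρ (t i) fun f hf => hF f ⟨i, hf⟩).cons .comma)
    -- Membership is tested as the negation of "every event of the session differs from the given
    -- one".
    have := (PolyBool.all (hsession hW hs) (q := fun a e =>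
      !(evStr e == evStr (⟨p, fun k => (t k).eval (ρ a)⟩ : Event L)))
      (PolyBool.not (PolyBool.eq .top (he.comap Prod.fst).lift
        fun z => notMem_evStr (by simp) (by simp) _))).not
    refine this.congr fun a => ?_
    obtain ⟨l, W', e⟩ := List.exists_cons_of_ne_nil (hW a)
    congr 2
    dsimp only
    rw [e, Bool.eq_iff_iff, decide_eq_true_iff, holdsAt_atom]
    simp [evStr_injective.eq_iff]
  | rel R t =>
    obtain ⟨o, ho⟩ := hR R rfl
    exact PolyVal.call ho (PolyVal.codeTuple fun i => .term hρ (t i) fun f hf => hF f ⟨i, hf⟩)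
  | and ψ₁ ψ₂ ih₁ ih₂ =>
    refine (PolyBool.and (ih₁ (fun f hf => hF f (.inl hf)) (fun R h => hR R (.inl h)) hW hs hρ)
      (ih₂ (fun f hf => hF f (.inr hf)) (fun R h => hR R (.inr h)) hW hs hρ)).congr fun a => ?_
    simp [HoldsAt, Holds]
  | neg ψ ih =>
    refine (PolyBool.not (ih hF hR hW hs hρ)).congr fun a => ?_
    simp [HoldsAt, Holds]
  | prev ψ ih =>
    have ht : PolyVal orc s (fun a => historyStr (W a).tail) := by
      refine (hs.dropThrough .blank).congr fun a => ?_
      obtain ⟨l, W', e⟩ := List.exists_cons_of_ne_nil (hW a)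
      rw [e, dropThrough_historyStr]
      rfl
    refine (PolyBool.isEmpty ht).ite ((PolyBool.const false).congr fun a => ?_)
      ((ih (α := {a // (historyStr (W a).tail).isEmpty = false}) (W := fun a => (W a).tail)
        (ρ := fun a => ρ a) hF hR (fun a ha => ?_) (ht.comap _)
        (fun x => (hρ x).comap _)).congr fun a => ?_)
    · obtain ⟨l, W', e⟩ := List.exists_cons_of_ne_nil (hW a.1)
      have ha := a.2
      rw [historyStr_isEmpty, e] at ha
      dsimp only
      simp_all [holdsAt_prev]
    · have h := a.2
      rw [historyStr_isEmpty, ha] at h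
      simp at h
    · obtain ⟨l, W', e⟩ := List.exists_cons_of_ne_nil (hW a.1)
      have ha := a.2
      rw [historyStr_isEmpty, e] at ha
      dsimp only
      simp_all [holdsAt_prev]
  | since ψ₁ ψ₂ ih₁ ih₂ =>
    have hρ' : ∀ x, PolyVal orc (fun z : α × Option Bool × List (Event L) × List (List (Event L)) =>
        historyStr (z.2.2.1 :: z.2.2.2) :: bits z.2.1.toList :: s z.1)
        (fun z => bits (L.code (ρ z.1 x))) := fun x => ((hρ x).comap Prod.fst).lift.lift
    have h1 := ih₁ (fun f hf => hF f (.inl hf)) (fun R h => hR R (.inl h))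
      (W := fun z : α × Option Bool × List (Event L) × List (List (Event L)) =>
        z.2.2.1 :: z.2.2.2) (by simp) .top hρ'
    have h2 := ih₂ (fun f hf => hF f (.inr hf)) (fun R h => hR R (.inr h))
      (W := fun z : α × Option Bool × List (Event L) × List (List (Event L)) =>
        z.2.2.1 :: z.2.2.2) (by simp) .top hρ'
    have hb : PolyVal orc (fun z : α × Option Bool × List (Event L) × List (List (Event L)) =>
        historyStr (z.2.2.1 :: z.2.2.2) :: bits z.2.1.toList :: s z.1)
        (fun z => bits z.2.1.toList) := PolyVal.top.lift
    -- An undecided state is written as the empty string and a decided one as a single bit, so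
    -- emptiness tells whether the unfolding goes on.
    have hstep := (PolyBool.isEmpty hb).cond (h2.cond (PolyVal.const [.bit true])
      (h1.cond PolyVal.nil (PolyVal.const [.bit false]))) hb
    have h := PolyVal.foldTails (orc := orc) (s := s) (encL := historyStr)
      (code := fun b : Option Bool => bits b.toList) (fun b => by cases b <;> simp [bits])
      (fun a b l W => sinceStep (decide (HoldsAt (l :: W) ψ₁ (ρ a)))
        (decide (HoldsAt (l :: W) ψ₂ (ρ a))) b) rfl historyStr_length_lt
      ((PolyVal.top.dropThrough .blank).congr fun z => (dropThrough_historyStr _ _).symm)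
      (hstep.congr fun z => ?_) hs (b := fun _ => none) (PolyVal.const [])
    · refine (PolyBool.head h (fun o => o == some (.bit true))).congr fun a => ?_
      congr 2
      rw [Bool.eq_iff_iff, decide_eq_true_iff, ← foldTails_since]
      have : ∀ b : Option Bool, b = some true ↔
          ((bits b.toList).head? == some (.bit true)) = true := by
        rintro (_ | _ | _) <;> simp [bits]
      exact this _
    · rcases h : z.2.1 with _ | b
      · cases hb1 : decide (HoldsAt (z.2.2.1 :: z.2.2.2) ψ₁ (ρ z.1)) <;>
        cases hb2 : decide (HoldsAt (z.2.2.1 :: z.2.2.2) ψ₂ (ρ z.1)) <;>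
        simp [sinceStep, bits]
      · simp [sinceStep, bits]
  | all p hp ψ ih =>
    have hq : PolyBool orc (fun z : α × Event L => evStr z.2 :: s z.1) (fun z => decide
        (∀ c, z.2 = ⟨p, c⟩ → HoldsAt (W z.1) ψ (extend c (ρ z.1)))) := by
      have hname := PolyBool.eq (orc := orc) (s := fun z : α × Event L => evStr z.2 :: s z.1)
        (PolyVal.top.takeUntil .comma) (PolyVal.const (bits (L.predName p))) (fun z => by
          rw [takeUntil_evStr]; exact notMem_bits (by simp) _)
      have hz : ∀ z : α × Event L, (takeUntil .comma (evStr z.2) == bits (L.predName p)) = true →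
          z.2.1 = p := fun z hz => L.predName_injective <| bits_injective <| by
        rwa [takeUntil_evStr, beq_iff_eq] at hz
      refine hname.ite ((ih hF hR (α := {z : α × Event L //
        (takeUntil .comma (evStr z.2) == bits (L.predName p)) = true})
        (W := fun z => W z.1.1) (ρ := fun z => extend (argsOf (hz z.1 z.2)) (ρ z.1.1))
        (fun z => hW _) (hs.comap fun z : {z : α × Event L //
        (takeUntil .comma (evStr z.2) == bits (L.predName p)) = true} => z.1.1).lift ?_).congr fun z => ?_)
        ((PolyBool.const true).congr fun z => ?_)
      · rintro (k | x)
        -- The first `dropThrough` skips the predicate name; the `k`-th argument then begins after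
        -- `k` more commas.
        · refine ((((PolyVal.top.dropThrough .comma).dropThrough_iterate .comma k).takeUntil
            .comma)).congr fun z => ?_
          rw [← codeTuple_argsOf (hz z.1 z.2), takeUntil_codeTuple]
          rfl
        · exact ((hρ x).comap fun z : {z : α × Event L //
            (takeUntil .comma (evStr z.2) == bits (L.predName p)) = true} => z.1.1).lift
      · simp only [eq_mk_iff (hz z.1 z.2), forall_eq']
      -- Events with another predicate symbol satisfy the guarded condition vacuously.
      · have h : z.1.2.1 ≠ p := fun h => by simpa [takeUntil_evStr, h] using z.2
        congr 2
        simp only [decide_eq_true_eq]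
        rintro c e
        exact absurd (congrArg Sigma.fst e) h
    refine (PolyBool.all (hsession hW hs) (q := fun a e => decide
      (∀ c, e = ⟨p, c⟩ → HoldsAt (W a) ψ (extend c (ρ a)))) hq).congr fun a => ?_
    obtain ⟨l, W', e⟩ := List.exists_cons_of_ne_nil (hW a)
    congr 2
    dsimp only
    rw [e, Bool.eq_iff_iff, decide_eq_true_iff, holdsAt_all]
    simp

end

noncomputable section

/-! ### Reading the input -/

section Read

variable {L : Signature} {O : Type} {orc : O → TM2ComputableAux Γ' Bool} [Finite O] {α : Type}

/-- Read a history backwards. The state consists of the closing brackets that are open, the part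
of the current session that has been read, and the sessions that have been read. -/
def readStep (b : Str × Str × Str) : Γ' → Str × Str × Str
  | .ket => (.ket :: b.1, (bif b.1.isEmpty then .blank else .ket) :: b.2.1, b.2.2)
  | .bra => (b.1.tail, bif b.1.tail.isEmpty then [] else b.2.1,
      bif b.1.tail.isEmpty then b.2.2 ++ b.2.1 else b.2.2)
  | .bit c => (b.1, .bit c :: b.2.1, b.2.2)
  | .comma => (b.1, .comma :: b.2.1, b.2.2)
  | .blank => (b.1, .blank :: b.2.1, b.2.2)

theorem foldr_readStep_of_plain {l : Str} (h : .ket ∉ l) (h' : .bra ∉ l) (f c t : Str) :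
    l.foldr (fun x b => readStep b x) (f, c, t) = (f, l ++ c, t) := by
  induction l with
  | nil => rfl
  | cons x l ih =>
    simp only [List.mem_cons, not_or] at h h'
    rw [List.foldr_cons, ih h.2 h'.2]
    cases x <;> simp_all [readStep]

theorem foldr_readStep_codeEvent (e : Event L) (c t : Str) :
    (codeEvent e).foldr (fun x b => readStep b x) ([.ket], c, t) =
      ([.ket], evStr e ++ .ket :: c, t) := by
  have he : codeEvent e = .bra :: (evStr e ++ [.ket]) := by simp [codeEvent, evStr, bits]
  rw [he, List.foldr_cons, List.foldr_append]
  simp only [List.foldr_cons, List.foldr_nil]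
  rw [readStep, foldr_readStep_of_plain (notMem_evStr (by simp) (by simp) e)
    (notMem_evStr (by simp) (by simp) e)]
  simp [readStep]

theorem foldr_readStep_events (l : List (Event L)) (c t : Str) :
    (l.map codeEvent).flatten.foldr (fun x b => readStep b x) ([.ket], c, t) =
      ([.ket], sessionStr l ++ c, t) := by
  induction l with
  | nil => rfl
  | cons e l ih =>
    rw [List.map_cons, List.flatten_cons, List.foldr_append, ih, foldr_readStep_codeEvent,
      sessionStr_cons]
    simp

/-- Reading backwards completes the newest session first, and later completed, older sessions are
appended; hence the reversed list. The count of open closing brackets distinguishes the end of a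
session, which becomes a blank, from the end of an event, which stays a bracket. -/
theorem foldl_readStep_code (w : Listing L) :
    w.code.reverse.foldl readStep ([], [], []) = ([], [], historyStr w.1.reverse) := by
  rw [List.foldl_reverse, Listing.code]
  induction w.1 with
  | nil => rfl
  | cons l w ih =>
    rw [List.map_cons, List.flatten_cons, List.foldr_append, ih, List.cons_append,
      List.foldr_cons, List.foldr_append]
    simp only [List.foldr_cons, List.foldr_nil]
    rw [readStep, foldr_readStep_events]
    simp [readStep, historyStr]

theorem PolyVal.history :
    PolyVal orc (fun w : Listing L => [w.code.reverse]) (fun w => historyStr w.1.reverse) := by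
  refine PolyVal.foldl (rep := fun b : Str × Str × Str => [b.1, b.2.1, b.2.2])
    (step := readStep) (b := fun _ => ([], [], [])) 2 ?_ (fun x => ?_)
    (PolyVal.top (s := fun _ => [])) [fun _ => [], fun _ => [], fun _ => []]
    (by simpa using PolyVal.nil) (fun _ => rfl)
    (new := [fun _ => [], fun _ => [], fun w => historyStr w.1.reverse]) (fun w => ?_) (by simp)
  -- A closing bracket lengthens two of the three strings by one symbol each, whence the bound 2;
  -- completing a session merely moves symbols from one string to another.
  · rintro ⟨f, c, t⟩ x
    have : f.tail.length ≤ f.length := by simp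
    cases x <;> simp only [readStep, size_cons, size_nil, List.length_cons] <;> try omega
    cases f.tail.isEmpty <;> simp <;> omega
  · have h1 : PolyVal orc (fun z : Listing L × Str × Str × Str =>
        [z.2.1, z.2.2.1, z.2.2.2] ++ [z.1.code.reverse]) (fun z => z.2.1) := .top
    have h2 : PolyVal orc (fun z : Listing L × Str × Str × Str =>
        [z.2.1, z.2.2.1, z.2.2.2] ++ [z.1.code.reverse]) (fun z => z.2.2.1) := .lift .top
    have h3 : PolyVal orc (fun z : Listing L × Str × Str × Str =>
        [z.2.1, z.2.2.1, z.2.2.2] ++ [z.1.code.reverse]) (fun z => z.2.2.2) := .lift (.lift .top)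
    refine PolyVal.assign [fun z : Listing L × Str × Str × Str => z.2.1, fun z => z.2.2.1,
      fun z => z.2.2.2] (new := [fun z => (readStep z.2 x).1, fun z => (readStep z.2 x).2.1,
      fun z => (readStep z.2 x).2.2]) ?_
    simp only [List.mem_cons, List.not_mem_nil, or_false, forall_eq_or_imp, forall_eq]
    cases x with
    | blank => exact ⟨h1, h2.cons _, h3⟩
    | bit c => exact ⟨h1, h2.cons _, h3⟩
    | comma => exact ⟨h1, h2.cons _, h3⟩
    | ket =>
      refine ⟨h1.cons _, ((PolyBool.isEmpty h1).cond (h2.cons .blank) (h2.cons .ket)).congr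
        fun z => ?_, h3⟩
      cases h : z.2.1.isEmpty <;> simp [readStep, h]
    | bra =>
      exact ⟨h1.tail, (PolyBool.isEmpty h1.tail).cond .nil h2,
        (PolyBool.isEmpty h1.tail).cond (h3.append h2) h3⟩
  · rw [foldl_readStep_code]
    rfl

end Read

/-! ### The machine -/

section Final

variable {O : Type} {orc : O → TM2ComputableAux Γ' Bool} [Finite O]

variable (orc) in
/-- Move the input to the data stack. -/
def readInput : Piece orc := (pushEmpty .data).seq (pump .inp some [⟨.reg .data, some⟩])

variable (orc) in
/-- Move a truth value from the data stack to the output. -/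
def writeOutput : Piece orc :=
  .single <| .pop (.reg .data) (fun v c => (c.join, v.2)) <|
    .push .out (fun v => v.1 == some (.bit true)) <| .pop (.reg .data) (fun v _ => v) <|
    .load (fun v => (none, v.2)) <| .goto fun _ => none

omit [Finite O] in
theorem readInput_does (l : Str) :
    (readInput orc).Does (2 * l.length + 2) (Function.update (fun _ => []) .inp l)
      (stackOf orc (regs [l.reverse] [] [])) := by
  have h1 := single_does (orc := orc) (q := .push (.reg .data) (fun _ => none) (.goto fun _ => none))
    (S := Function.update (fun _ => []) .inp l) (by simp; rfl)
  have h2 := pump_does (orc := orc) (src := .inp) (rd := some) (ds := [⟨.reg .data, some⟩])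
    (by simp) l l [] (by simp) rfl
    (Function.update (Function.update (fun _ => []) .inp l) (.reg .data) [none])
    (by rw [Function.update_of_ne (by simp)]; simp)
  refine (h1.seq h2).congr (by omega) rfl ?_
  rw [foldl_pushed_singleton]
  funext k
  rcases k with (_ | _ | _) | _ | _ | _ <;> simp [stackOf]

omit [Finite O] in
theorem writeOutput_does (b : Bool) :
    (writeOutput orc).Does 1 (stackOf orc (regs [[.bit b]] [] []))
      (Function.update (fun _ => []) .out [b]) := by
  refine single_does ?_
  have hb : (some (Γ'.bit b) == some (Γ'.bit true)) = b := by cases b <;> rfl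
  simp [idle, hb]
  funext k
  rcases k with (_ | _ | _) | _ | _ | _ <;> simp [stackOf]

/-- The machine that runs a piece of a program on its input. -/
def machine (F : Piece orc) : FinTM2 where
  K := Stk orc
  k₀ := .inp
  k₁ := .out
  kFin := inferInstance
  Γ := Alph orc
  Λ := Option F.Λ
  main := some F.entry
  ΛFin := by have := F.fin; exact Fintype.ofFinite _
  σ := Mem orc
  initialState := idle orc
  σFin := Fintype.ofFinite _
  Γk₀Fin := inferInstanceAs (Fintype Γ')
  m := F.prog

theorem nonempty_computable {X : Type} {code : X → Str} {b : X → Bool}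
    (h : PolyBool orc (fun x => [(code x).reverse]) b) :
    Nonempty (TM2ComputableInPolyTime code encodeBool b) := by
  -- The answer has to replace the input, because all stacks except the output must be empty at the
  -- end.
  obtain ⟨F, τ, ⟨p, hp⟩, hF⟩ : PolyStep orc (fun x => [(code x).reverse]) (fun x => [[.bit (b x)]]) :=
    PolyVal.assign (s := fun _ => []) [fun x => (code x).reverse] (new := [fun x => [.bit (b x)]])
      (by simpa using (show PolyVal orc _ _ from h))
  refine ⟨{
    tm := machine ((readInput orc).seq (F.seq (writeOutput orc)))
    inputAlphabet := Equiv.refl _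
    outputAlphabet := Equiv.refl _
    -- For `n` input symbols: reading takes `2 * n + 2` steps, the program at most `p (n + 1)` as
    -- the end marker counts, writing 1, and the halting step 1.
    time := 2 * .X + p.comp (.X + 1) + 4
    outputsFun := fun x => Classical.choice ?_ }⟩
  obtain ⟨n, hn, e⟩ := (readInput_does (code x)).seq ((hF x [] []).seq (writeOutput_does (b x)))
  have h1 := e.trans (.head (.refl _))
  have h2 : ∀ l l', l = code x → l' = [b x] →
      Steps (machine ((readInput orc).seq (F.seq (writeOutput orc)))).m (n + 1)
        (initList _ l) (haltList _ l') := by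
    rintro _ _ rfl rfl
    exact (congr (congrArg (Steps _ (n + 1)) (initList_eq (machine _) (code x)))
      (haltList_eq (machine _) [b x])).mpr h1
  refine ⟨⟨⟨n + 1, steps_iff.1 (h2 _ _ (List.map_id _) (List.map_id _))⟩, ?_⟩⟩
  · have := hp x
    simp at this ⊢
    omega

end Final

/-! ### Symbols of a formula -/

section Symbols

variable {L : Signature}

theorem Term.finite_hasFn {V : Type} {Γ : V → L.BaseType} {τ : L.BaseType} (t : Term L Γ τ) :
    {f | t.HasFn f}.Finite := by
  induction t with
  | var => simp [Term.HasFn]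
  | const => simp [Term.HasFn]
  | app g t ih =>
    refine ((Set.finite_singleton g).union (Set.finite_iUnion ih)).subset ?_
    rintro f (rfl | ⟨i, h⟩)
    · exact .inl rfl
    · exact .inr (Set.mem_iUnion.2 ⟨i, h⟩)

theorem Formula.finite_hasFn {V : Type} {Γ : V → L.BaseType} (ψ : Formula L Γ) :
    {f | ψ.HasFn f}.Finite := by
  induction ψ with
  | atom p t =>
    exact (Set.finite_iUnion fun i => (t i).finite_hasFn).subset fun f ⟨i, h⟩ =>
      Set.mem_iUnion.2 ⟨i, h⟩
  | rel R t =>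
    exact (Set.finite_iUnion fun i => (t i).finite_hasFn).subset fun f ⟨i, h⟩ =>
      Set.mem_iUnion.2 ⟨i, h⟩
  | and _ _ ih ih' => exact ih.union ih'
  | neg _ ih => exact ih
  | prev _ ih => exact ih
  | since _ _ ih ih' => exact ih.union ih'
  | all _ _ _ ih => exact ih

theorem Formula.finite_hasRel {V : Type} {Γ : V → L.BaseType} (ψ : Formula L Γ) :
    {R | ψ.HasRel R}.Finite := by
  induction ψ with
  | atom p t => simp [Formula.HasRel]
  | rel R t => exact (Set.finite_singleton R).subset fun S h => h.symm
  | and _ _ ih ih' => exact ih.union ih'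
  | neg _ ih => exact ih
  | prev _ ih => exact ih
  | since _ _ ih ih' => exact ih.union ih'
  | all _ _ _ ih => exact ih

end Symbols

theorem satisfies_iff_holdsAt {L : Signature} (w : Listing L) (φ : Policy L) :
    Satisfies w.toHistory φ ↔ HoldsAt w.1.reverse φ (fun x => x.elim) := by
  simp [Satisfies, HoldsAt, Listing.toHistory]

end

end PTLTL

theorem theorem2 (L : PTLTL.Signature) (φ : PTLTL.Policy L)
    (hFn : ∀ f : L.Fn, PTLTL.Formula.HasFn f φ → L.PolyTimeFn f)
    (hRel : ∀ R : L.Rel, PTLTL.Formula.HasRel R φ → L.PolyTimeRel R) :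
    PTLTL.Policy.DecidableInPolyTime φ := by
  classical
  let F := fun f : {f // PTLTL.Formula.HasFn f φ} => Classical.choice (hFn f.1 f.2)
  let R := fun R : {R // PTLTL.Formula.HasRel R φ} => Classical.choice (hRel R.1 R.2)
  have : Finite {f // PTLTL.Formula.HasFn f φ} := φ.finite_hasFn
  have : Finite {R // PTLTL.Formula.HasRel R φ} := φ.finite_hasRel
  -- There is one oracle for each function or relation symbol that occurs in the policy. The two
  -- finiteness facts above make this family, and thereby the compound machine, finite.
  have h := PTLTL.PolyBool.holdsAt (orc := Sum.elim (fun f => (F f).toTM2ComputableAux)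
    fun R' => (R R').toTM2ComputableAux) φ
    (fun f hf => ⟨.inl ⟨f, hf⟩, (F ⟨f, hf⟩).time, fun c => ⟨(F ⟨f, hf⟩).outputsFun c⟩⟩)
    (fun S hS => ⟨.inr ⟨S, hS⟩, (R ⟨S, hS⟩).time, fun c => ⟨(R ⟨S, hS⟩).outputsFun c⟩⟩)
    (W := fun w : PTLTL.Listing L => w.1.reverse) (fun w => by simpa using w.2)
    (ρ := fun _ x => x.elim) PTLTL.PolyVal.history (fun x => x.elim)
  refine PTLTL.nonempty_computable (h.congr fun w => ?_)
  simp only [PTLTL.satisfies_iff_holdsAt]
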